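/- **Setting.** An extended arithmetic circuit with $n$ inputs, $\ell$ auxiliary memory gates and $m$ outputs over a set $\mathcal A$ of functions $\mathbb R\to\mathbb R$ is a finite simple DAG of ordered gates: $n$ input gates and $\ell$ auxiliary memory gates (indegree $0$), $m$ output gates (indegree $1$, outdegree $0$), constant gates, addition and multiplication gates of arbitrary fan-in, and gates for functions of $\mathcal A$ (indegree and outdegree $1$). A recurrent circuit consists of such a circuit $C$, initial values of the auxiliary memory gates, one recurrent edge from a non-output gate to each input and auxiliary memory gate, an ordered set of $p$ halting gates, and a halting function $\mathbb N_{>0}\times\mathbb R^p\to\{0,1\}$. On input $\overline x$, $C$ is evaluated repeatedly; after the $t$-th evaluation the circuit stops and returns the values of its output gates if the halting function is $1$ on $t$ and the values of the halting gates, and otherwise each input and auxiliary memory gate takes the value of the source of its recurrent edge. $\mathrm{FAC}^i_{\mathbb R}[\mathcal A]$ stands for circuit families over $\mathcal A$ of size $n^{O(1)}$ and depth $O((\log n)^i)$. A recurrent circuit family $(C_n)_{n\in\mathbb N}$ ($C_n$ with $n$ inputs) is a $\mathrm{rec}[\mathfrak F']\text{-}\mathfrak F$-circuit family if its underlying circuits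 form an $\mathfrak F$-circuit family and its halting functions are computed by members of one $\mathfrak F'$-family of (non-extended) circuits, whose first input is the iteration number; as usual, its circuits halt on all inputs, so that it computes a function $\mathbb R^*\to\mathbb R^*$. The prefix $s$ (resp. $t$) means that the function computed by the recurrent family is invariant under all permutations of its arguments (resp. of its arguments other than the first). For $\mathfrak F=\mathrm{FAC}^i_{\mathbb R}[\mathcal A_0]$ put $\mathfrak F_s=\mathrm{FAC}^i_{\mathbb R}[\mathcal A_0\cup\{\mathrm{sign}\}]$, where $\mathrm{sign}(x)=1$ if $x>0$ and $0$ otherwise, and $\mathfrak F[\mathcal A]=\mathrm{FAC}^i_{\mathbb R}[\mathcal A_0\cup\mathcal A]$. A one-layer $(\mathrm{rec}[\mathfrak F_s]\text{-}t\mathfrak F[\mathcal A],\{\mathrm{id}\})$-GNN is given by a real-valued function $f'$ computed by a $\mathrm{rec}[\mathfrak F_s]\text{-}t\mathfrak F[\mathcal A]$-circuit family. It maps a labelled graph $(V,E,g)$ with $g:V\to\mathbb R$ to $(V,E,h)$ with $h(v)=f'\bigl(g(v),\{\!\{g(u): u \text{ a neighbour of } v\}\!\}\bigr)$, and it halts after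 layer $1$. A symbolic logspace graph encoding is a map from recurrent circuits (given together with a circuit computing the halting function) to graphs whose vertices are labelled with symbols $\mathit{in}_i$, $\mathit{aux}_i$, $\mathit{const}_i$ or natural numbers at most $|V|$, such that some logspace transducer maps a fixed binary encoding of each circuit (in which gates occur with their types and indices, without real values) to the binary encoding of its graph. Given an input $\overline x$, the symbols $\mathit{in}_i$, $\mathit{aux}_i$, $\mathit{const}_i$ are then replaced by $x_i$, by the initial value of the $i$-th auxiliary memory gate, and by the value of the $i$-th constant gate. **Theorem.** Let $i\in\mathbb N$, let $\mathcal A_0,\mathcal A$ be sets of functions $\mathbb R\to\mathbb R$, let $\mathfrak F=\mathrm{FAC}^i_{\mathbb R}[\mathcal A_0]$, and let $\mathcal C=(C_n)_{n\in\mathbb N}$ be a $\mathrm{rec}[\mathfrak F_s]\text{-}s\mathfrak F[\mathcal A]$-circuit family. Mapping a recurrent circuit with $n$ inputs and $m$ outputs to the complete bipartite graph between $n$ input nodes labelled $\mathit{in}_1,\dots,\mathit{in}_n$ and $m$ output nodes labelled $1,\dots,m$ is a symbolic logspace graph encoding. Moreover, there is a one-layer $(\mathrm{rec}[\mathfrak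 F_s]\text{-}t\mathfrak F[\mathcal A],\{\mathrm{id}\})$-GNN $\mathcal N$ such that for all $n\in\mathbb N$ and $\overline x\in\mathbb R^n$, if $\mathcal N$ is applied to the graph of $C_n$ in which the input nodes carry the labels $x_1,\dots,x_n$, then the $m$ output nodes, in order, end up with the feature values $f_{C_n}(\overline x)$. -/

import Mathlib

namespace RecGNN

/-! ### Arithmetic circuits -/

/-- The label of a gate in a circuit with `n` inputs, `l` auxiliary memory gates and `m` outputs. -/
inductive GateKind (n l m : ℕ) where
  | input (i : Fin n)
  | aux (i : Fin l)
  | output (i : Fin m)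
  | const (c : ℝ)
  | add
  | mul
  | func (f : ℝ → ℝ)

/-- An extended arithmetic circuit with `n` inputs, `l` auxiliary memory gates, `m` outputs and
function gates from `A`: a finite simple directed acyclic graph of labelled gates, given by the set
of predecessors of each gate. For `l = 0` this is an arithmetic circuit. -/
structure Circuit (A : Set (ℝ → ℝ)) (n l m : ℕ) where
  Gate : Type
  size : ℕ
  /-- the order on the gates -/
  order : Gate ≃ Fin size
  kind : Gate → GateKind n l m
  pred : Gate → Finset Gate
  /-- acyclicity (for finite graphs this is well-foundedness) -/
  acyclic : WellFounded fun g h => g ∈ pred h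
  inGate : Fin n → Gate
  auxGate : Fin l → Gate
  outGate : Fin m → Gate
  /-- there is exactly one `i`-th input gate, and likewise below -/
  kind_input : ∀ g i, kind g = .input i ↔ g = inGate i
  kind_aux : ∀ g i, kind g = .aux i ↔ g = auxGate i
  kind_output : ∀ g i, kind g = .output i ↔ g = outGate i
  pred_input : ∀ i, pred (inGate i) = ∅
  pred_aux : ∀ i, pred (auxGate i) = ∅
  pred_const : ∀ g c, kind g = .const c → pred g = ∅
  pred_output : ∀ i, (pred (outGate i)).card = 1
  succ_output : ∀ i h, outGate i ∉ pred h
  func_mem : ∀ g f, kind g = .func f → f ∈ A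
  pred_func : ∀ g f, kind g = .func f → (pred g).card = 1
  succ_func : ∀ g f, kind g = .func f → ∃! h, g ∈ pred h

namespace Circuit

variable {A : Set (ℝ → ℝ)} {n l m : ℕ}

/-- The value of a gate from the values of its predecessors. Output and function gates have exactly
one predecessor, so that the sum over the predecessors is the value of that predecessor. -/
noncomputable def eval (C : Circuit A n l m) (x : Fin n → ℝ) (a : Fin l → ℝ) : C.Gate → ℝ :=
  C.acyclic.fix fun g val =>
    match C.kind g with
    | .input i => x i
    | .aux i => a i
    | .const c => c
    | .output _ => ∑ h ∈ (C.pred g).attach, val h.1 h.2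
    | .add => ∑ h ∈ (C.pred g).attach, val h.1 h.2
    | .mul => ∏ h ∈ (C.pred g).attach, val h.1 h.2
    | .func f => f (∑ h ∈ (C.pred g).attach, val h.1 h.2)

theorem eval_eq (C : Circuit A n l m) (x : Fin n → ℝ) (a : Fin l → ℝ) (g : C.Gate) :
    C.eval x a g =
      match C.kind g with
      | .input i => x i
      | .aux i => a i
      | .const c => c
      | .output _ => ∑ h ∈ C.pred g, C.eval x a h
      | .add => ∑ h ∈ C.pred g, C.eval x a h
      | .mul => ∏ h ∈ C.pred g, C.eval x a h
      | .func f => f (∑ h ∈ C.pred g, C.eval x a h) := by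
  rw [eval, WellFounded.fix_eq]
  rw [Finset.sum_attach (C.pred g) (fun h => C.acyclic.fix _ h),
    Finset.prod_attach (C.pred g) (fun h => C.acyclic.fix _ h)]

/-- The function computed by the circuit. -/
noncomputable def outputs (C : Circuit A n l m) (x : Fin n → ℝ) (a : Fin l → ℝ) : Fin m → ℝ :=
  fun j => C.eval x a (C.outGate j)

/-- `C.Path g h k`: there is a directed path of length `k` from `g` to `h`. -/
inductive Path (C : Circuit A n l m) (g : C.Gate) : C.Gate → ℕ → Prop where
  | nil : Path C g g 0
  | snoc {h h' : C.Gate} {k : ℕ} : Path C g h k → h ∈ C.pred h' → Path C g h' (k + 1)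

/-- Path lengths are bounded, so the suprema below are maxima. -/
theorem path_bddAbove (C : Circuit A n l m) : BddAbove {k | ∃ g h, C.Path g h k} := by
  have key : ∀ h, ∃ B, ∀ g k, C.Path g h k → k ≤ B := by
    intro h
    induction h using C.acyclic.induction with
    | _ h ih =>
      choose! B hB using ih
      refine ⟨(C.pred h).sup B + 1, fun g k hk => ?_⟩
      cases hk with
      | nil => exact Nat.zero_le _
      | snoc hp hmem =>
        exact Nat.succ_le_succ ((hB _ hmem _ _ hp).trans (Finset.le_sup (f := B) hmem))
  choose B hB using key
  have : Fintype C.Gate := Fintype.ofEquiv _ C.order.symm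
  refine ⟨Finset.univ.sup B, ?_⟩
  rintro k ⟨g, h, hk⟩
  exact (hB h g k hk).trans (Finset.le_sup (f := B) (Finset.mem_univ h))

/-- The depth of an extended circuit: the maximal length of a path between any two gates. -/
noncomputable def depth (C : Circuit A n l m) : ℕ := sSup {k | ∃ g h, C.Path g h k}

/-- The depth of a (non-extended) circuit: the maximal length of a path from an input gate to an
output gate. -/
noncomputable def ioDepth (C : Circuit A n l m) : ℕ :=
  sSup {k | ∃ i j, C.Path (C.inGate i) (C.outGate j) k}

end Circuit

/-- `sign x = 1` if `x > 0`, and `0` otherwise. -/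
noncomputable def sign (x : ℝ) : ℝ := if 0 < x then 1 else 0

/-- Size `O(n ^ O(1))` and depth `O((log n) ^ i)`. -/
def IsFACBound (i : ℕ) (size depth : ℕ → ℕ) : Prop :=
  (∃ k : ℕ, (fun n => (size n : ℝ)) =O[Filter.atTop] fun n : ℕ => (n : ℝ) ^ k) ∧
    (fun n => (depth n : ℝ)) =O[Filter.atTop] fun n : ℕ => Real.log n ^ i

/-- A family of (non-extended) arithmetic circuits. -/
structure CircuitFamily (A : Set (ℝ → ℝ)) where
  out : ℕ → ℕ
  circ : ∀ n, Circuit A n 0 (out n)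

/-- The family obeys the size and depth bounds of `FAC^i[A]`. -/
def CircuitFamily.IsFAC {A : Set (ℝ → ℝ)} (i : ℕ) (H : CircuitFamily A) : Prop :=
  IsFACBound i (fun n => (H.circ n).size) (fun n => (H.circ n).ioDepth)

/-! ### Recurrent arithmetic circuits -/

/-- A recurrent arithmetic circuit with `n` inputs, `l` auxiliary memory gates and `m` outputs. -/
structure RecCircuit (A : Set (ℝ → ℝ)) (n l m : ℕ) where
  /-- the underlying extended circuit -/
  C : Circuit A n l m
  /-- initial values of the auxiliary memory gates -/
  init : Fin l → ℝ
  /-- sources of the recurrent edges into the input gates and the auxiliary memory gates -/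
  recIn : Fin n → C.Gate
  recAux : Fin l → C.Gate
  recIn_ne : ∀ i j, recIn i ≠ C.outGate j
  recAux_ne : ∀ i j, recAux i ≠ C.outGate j
  /-- the ordered set of halting gates -/
  p : ℕ
  haltGate : Fin p ↪ C.Gate
  halt : ℕ+ → (Fin p → ℝ) → Bool

namespace RecCircuit

variable {A : Set (ℝ → ℝ)} {n l m : ℕ}

/-- `R.Mem i x a o`: the computation that is in iteration `i` with memory gate values `x`, `a`
eventually halts with output `o`. -/
inductive Mem (R : RecCircuit A n l m) :
    ℕ+ → (Fin n → ℝ) → (Fin l → ℝ) → (Fin m → ℝ) → Prop where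
  | halted (i : ℕ+) (x : Fin n → ℝ) (a : Fin l → ℝ)
      (h : R.halt i (fun j => R.C.eval x a (R.haltGate j)) = true) :
      Mem R i x a (R.C.outputs x a)
  | next (i : ℕ+) (x : Fin n → ℝ) (a : Fin l → ℝ) (o : Fin m → ℝ)
      (h : R.halt i (fun j => R.C.eval x a (R.haltGate j)) = false)
      (hn : Mem R (i + 1) (fun j => R.C.eval x a (R.recIn j))
        (fun j => R.C.eval x a (R.recAux j)) o) :
      Mem R i x a o

/-- The recurrent circuit halts on input `x` with output `o`. -/
def HaltsWith (R : RecCircuit A n l m) (x : Fin n → ℝ) (o : Fin m → ℝ) : Prop :=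
  R.Mem 1 x R.init o

end RecCircuit

/-- The circuit `H` (with the iteration number as its first input) computes the given halting
function. -/
def ComputesHalt {B : Set (ℝ → ℝ)} {p q : ℕ} (H : Circuit B (p + 1) 0 q)
    (halt : ℕ+ → (Fin p → ℝ) → Bool) : Prop :=
  q = 1 ∧ ∀ (t : ℕ+) (v : Fin p → ℝ) (k : Fin q),
    H.outputs (Fin.cons ((t : ℕ) : ℝ) v) Fin.elim0 k = if halt t v then 1 else 0

structure RecCircuitFamily (A : Set (ℝ → ℝ)) where
  aux : ℕ → ℕ
  out : ℕ → ℕ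
  circ : ∀ n, RecCircuit A n (aux n) (out n)

namespace RecCircuitFamily

variable {A : Set (ℝ → ℝ)}

/-- The underlying circuits obey the bounds of `FAC^i[A]`, and the halting functions belong to a
circuit family that obeys the bounds of `FAC^i[B]`. -/
def IsRecFAC (i : ℕ) (B : Set (ℝ → ℝ)) (R : RecCircuitFamily A) : Prop :=
  IsFACBound i (fun n => (R.circ n).C.size) (fun n => (R.circ n).C.depth) ∧
    ∃ H : CircuitFamily B, H.IsFAC i ∧
      ∀ n, ComputesHalt (H.circ ((R.circ n).p + 1)) (R.circ n).halt

/-- The family computes the (total) function `f : ℝ* → ℝ*`; tuples of reals are lists. -/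
def Computes (R : RecCircuitFamily A) (f : List ℝ → List ℝ) : Prop :=
  ∀ n (x : Fin n → ℝ), ∃ o, (R.circ n).HaltsWith x o ∧ f (List.ofFn x) = List.ofFn o

end RecCircuitFamily

/-- The recurrent circuit function class `rec[FAC^i[B]]-FAC^i[A]`. -/
def recClass (i : ℕ) (B A : Set (ℝ → ℝ)) : Set (List ℝ → List ℝ) :=
  {f | ∃ R : RecCircuitFamily A, R.IsRecFAC i B ∧ R.Computes f}

/-- Invariance under all permutations of the arguments. -/
def IsSymmetric {α : Type} (f : List ℝ → α) : Prop :=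
  ∀ u v : List ℝ, u.Perm v → f u = f v

/-- Invariance under all permutations of the arguments other than the first. -/
def IsTailSymmetric {α : Type} (f : List ℝ → α) : Prop :=
  ∀ (a : ℝ) (u v : List ℝ), u.Perm v → f (a :: u) = f (a :: v)

/-- The real-valued functions in `rec[FAC^i[B]]-tFAC^i[A]`. -/
def tailRecClass (i : ℕ) (B A : Set (ℝ → ℝ)) : Set (List ℝ → ℝ) :=
  {f | IsTailSymmetric f ∧ (fun x => [f x]) ∈ recClass i B A}

/-! ### Labelled graphs and circuit graph neural networks -/

/-- A finite undirected graph with an ordered vertex set and labels in `L`. -/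
structure LabelledGraph (L : Type) where
  card : ℕ
  graph : SimpleGraph (Fin card)
  label : Fin card → L

/-- The values of `g` at the neighbours of `v`, in the order of the vertices. -/
noncomputable def LabelledGraph.nbrValues {L : Type} (G : LabelledGraph L) (g : Fin G.card → ℝ)
    (v : Fin G.card) : List ℝ :=
  open Classical in ((List.finRange G.card).filter fun w => G.graph.Adj v w).map g

/-- A recurrent C-GNN whose layer functions are from `S` and whose activation functions are
from `Act`. The halting function reads the layer number and the multiset of feature values. -/
structure CGNN (S : Set (List ℝ → ℝ)) (Act : Set (ℝ → ℝ)) where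
  layer : ℕ → (List ℝ → ℝ) × (ℝ → ℝ)
  layer_mem : ∀ i, (layer i).1 ∈ S ∧ (layer i).2 ∈ Act
  periodic : ∃ d, 0 < d ∧ Function.Periodic layer d
  halt : ℕ+ → Multiset ℝ → Bool

namespace CGNN

variable {S : Set (List ℝ → ℝ)} {Act : Set (ℝ → ℝ)}

/-- The feature values after layer `i`. -/
noncomputable def features (N : CGNN S Act) (G : LabelledGraph ℝ) : ℕ → Fin G.card → ℝ
  | 0 => G.label
  | i + 1 => fun v =>
      (N.layer (i + 1)).2 ((N.layer (i + 1)).1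
        (N.features G i v :: G.nbrValues (N.features G i) v))

/-- The halting function evaluates to `1` after layer `t`. -/
def HaltsAt (N : CGNN S Act) (G : LabelledGraph ℝ) (t : ℕ+) : Prop :=
  N.halt t (Finset.univ.val.map (N.features G t)) = true

/-- The (partial) function computed by the network maps `G` to the labelled graph `G'`. -/
def Computes (N : CGNN S Act) (G G' : LabelledGraph ℝ) : Prop :=
  ∃ t : ℕ+, N.HaltsAt G t ∧ (∀ s < t, ¬ N.HaltsAt G s) ∧
    G' = ⟨G.card, G.graph, N.features G t⟩

/-- The halting of the network is determined by the fixed layer number `d`: there is no outer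
recurrence, and the network has `d` layers. -/
def HasFixedLayers (N : CGNN S Act) (d : ℕ+) : Prop :=
  ∀ t M, N.halt t M = decide (t = d)

end CGNN

/-! ### Binary encodings -/

/-- The self-delimiting code `1 ^ k 0` of a natural number. -/
def unary (k : ℕ) : List Bool := List.replicate k true ++ [false]

/-- Gate type, followed by the index of an input, auxiliary memory or output gate, or for constants
and function gates the index `pos` in the order of all gates. -/
def GateKind.code {n l m : ℕ} (pos : ℕ) : GateKind n l m → List Bool
  | .input i => [false, false, false] ++ unary i
  | .aux i => [false, false, true] ++ unary i
  | .output i => [false, true, false] ++ unary i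
  | .const _ => [false, true, true] ++ unary pos
  | .add => [true, false, false]
  | .mul => [true, false, true]
  | .func _ => [true, true, false] ++ unary pos

/-- Numbers of inputs, outputs, auxiliary memory gates and gates; then for each gate its type and a
bit vector that marks its predecessors. Real values do not occur. -/
noncomputable def Circuit.code {A : Set (ℝ → ℝ)} {n l m : ℕ} (C : Circuit A n l m) : List Bool :=
  open Classical in
  unary n ++ unary m ++ unary l ++ unary C.size ++
    (List.finRange C.size).flatMap fun k =>
      (C.kind (C.order.symm k)).code k ++
        (List.finRange C.size).map fun j => decide (C.order.symm j ∈ C.pred (C.order.symm k))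

/-- The values of the constant gates of a circuit, in the order of its gates. -/
noncomputable def Circuit.constValues {A : Set (ℝ → ℝ)} {n l m : ℕ} (C : Circuit A n l m) :
    List ℝ :=
  (List.finRange C.size).filterMap fun k =>
    match C.kind (C.order.symm k) with
    | .const c => some c
    | _ => none

/-- A recurrent circuit over `A`, together with a circuit over `B` computing its halting function. -/
structure Circ (B A : Set (ℝ → ℝ)) where
  n : ℕ
  l : ℕ
  m : ℕ
  R : RecCircuit A n l m
  H : Circuit B (R.p + 1) 0 1
  H_computes : ComputesHalt H R.halt

/-- The binary encoding of a recurrent circuit: the underlying circuit, the sources of the recurrent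
edges, the halting gates, and the circuit computing the halting function. -/
noncomputable def Circ.code {B A : Set (ℝ → ℝ)} (D : Circ B A) : List Bool :=
  D.R.C.code ++
    (List.finRange D.n).flatMap (fun i => unary (D.R.C.order (D.R.recIn i))) ++
    (List.finRange D.l).flatMap (fun i => unary (D.R.C.order (D.R.recAux i))) ++
    unary D.R.p ++
    (List.finRange D.R.p).flatMap (fun i => unary (D.R.C.order (D.R.haltGate i))) ++
    D.H.code

/-- Symbolic labels: `in_i`, `aux_i`, `const_i`, and natural numbers. -/
inductive Symbol where
  | inp (i : ℕ)
  | aux (i : ℕ)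
  | const (i : ℕ)
  | num (x : ℕ)

/-- The symbols allowed in a symbolically labelled graph with `N` vertices; the indices of `in_i`,
`aux_i` and `const_i` start from `1`. -/
def Symbol.Valid (N : ℕ) : Symbol → Prop
  | .inp i => 1 ≤ i ∧ i ≤ N
  | .aux i => 1 ≤ i ∧ i ≤ N
  | .const i => 1 ≤ i ∧ i ≤ N
  | .num x => x ≤ N

def Symbol.code : Symbol → List Bool
  | .inp i => [false, false] ++ unary i
  | .aux i => [false, true] ++ unary i
  | .const i => [true, false] ++ unary i
  | .num x => [true, true] ++ unary x

/-- Symbolically labelled graphs. -/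
structure SymGraph extends LabelledGraph Symbol where
  valid : ∀ v, (label v).Valid card

/-- The binary encoding of a symbolically labelled graph: the number of vertices, the adjacency
matrix row by row, and the labels in the order of the vertices. -/
noncomputable def SymGraph.code (G : SymGraph) : List Bool :=
  open Classical in
  unary G.card ++
    ((List.finRange G.card).flatMap fun v =>
      (List.finRange G.card).map fun w => decide (G.graph.Adj v w)) ++
    (List.finRange G.card).flatMap fun v => (G.label v).code

theorem unary_append_inj {a b : ℕ} {s t : List Bool} (h : unary a ++ s = unary b ++ t) :
    a = b ∧ s = t := by
  induction a generalizing b with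
  | zero =>
    cases b with
    | zero => simpa [unary] using h
    | succ b => simp [unary, List.replicate_succ] at h
  | succ a ih =>
    cases b with
    | zero => simp [unary, List.replicate_succ] at h
    | succ b =>
      have := ih (b := b) (by simpa [unary, List.replicate_succ] using h)
      exact ⟨by rw [this.1], this.2⟩

theorem Symbol.code_append_inj {a b : Symbol} {s t : List Bool}
    (h : a.code ++ s = b.code ++ t) : a = b ∧ s = t := by
  cases a <;> cases b <;>
    simp only [Symbol.code, List.cons_append, List.nil_append, List.cons.injEq, reduceCtorEq,
      false_and, true_and, and_false] at h <;>
    first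
      | exact h.elim
      | (obtain ⟨rfl, rfl⟩ := unary_append_inj h; exact ⟨rfl, rfl⟩)

theorem flatMap_append_inj {α β : Type} {e e' : α → List β}
    (he : ∀ v s t, e v ++ s = e' v ++ t → e v = e' v ∧ s = t) (u : List α) {s t : List β}
    (h : u.flatMap e ++ s = u.flatMap e' ++ t) : (∀ v ∈ u, e v = e' v) ∧ s = t := by
  induction u with
  | nil => simpa using h
  | cons v u ih =>
    simp only [List.flatMap_cons, List.append_assoc] at h
    obtain ⟨h1, h2⟩ := he _ _ _ h
    obtain ⟨h3, h4⟩ := ih h2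
    refine ⟨fun w hw => ?_, h4⟩
    rcases List.mem_cons.1 hw with rfl | hw
    · exact h1
    · exact h3 w hw

/-- Decoding is well defined: the encoding of symbolically labelled graphs is injective. -/
theorem SymGraph.code_injective : Function.Injective SymGraph.code := by
  classical
  rintro ⟨⟨N, G, g⟩, hg⟩ ⟨⟨N', G', g'⟩, hg'⟩ h
  simp only [SymGraph.code, List.append_assoc] at h
  obtain ⟨hN, h⟩ := unary_append_inj h
  subst hN
  obtain ⟨h1, h2⟩ := flatMap_append_inj
    (fun v s t hst => List.append_inj hst (by simp)) _ h
  have h2' : (List.finRange N).flatMap (fun v => (g v).code) ++ [] =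
      (List.finRange N).flatMap (fun v => (g' v).code) ++ [] := by simpa using h2
  obtain ⟨h3, -⟩ := flatMap_append_inj
    (fun v s t hst => by
      obtain ⟨hc, hs⟩ := Symbol.code_append_inj hst
      exact ⟨by rw [hc], hs⟩) _ h2'
  have hG : G = G' := by
    ext v w
    have := h1 v (List.mem_finRange v)
    have := (List.map_inj_left.1 this) w (List.mem_finRange w)
    simpa using this
  have hl : g = g' := by
    funext v
    have h4 : (g v).code ++ [] = (g' v).code ++ [] := by rw [h3 v (List.mem_finRange v)]
    exact (Symbol.code_append_inj h4).1
  subst hG hl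
  rfl

/-- Replaces the symbols of a symbolically labelled graph by real values: `in_i` by `x_i`, `aux_i`
by the initial value of the `i`-th auxiliary memory gate, `const_i` by the value of the `i`-th
constant gate (of the underlying circuit, followed by the halting circuit). -/
noncomputable def Circ.symbolValue {B A : Set (ℝ → ℝ)} (D : Circ B A) (x : Fin D.n → ℝ) :
    Symbol → ℝ
  | .inp i => (List.ofFn x).getD (i - 1) 0
  | .aux i => (List.ofFn D.R.init).getD (i - 1) 0
  | .const i => (D.R.C.constValues ++ D.H.constValues).getD (i - 1) 0
  | .num y => y

/-- The labelled graph encoding that belongs to a symbolic one. -/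
noncomputable def labelledEncoding {B A : Set (ℝ → ℝ)} (E : Circ B A → SymGraph) (D : Circ B A)
    (x : Fin D.n → ℝ) : LabelledGraph ℝ :=
  ⟨(E D).card, (E D).graph, fun v => D.symbolValue x ((E D).label v)⟩

/-! ### Logspace transducers -/

inductive Dir where
  | left
  | stay
  | right

def Dir.move : Dir → ℕ → ℕ
  | .left, k => k - 1
  | .stay, k => k
  | .right, k => k + 1

/-- Input tape symbols: the end markers and the bits. -/
inductive InSym where
  | leftEnd
  | bit (b : Bool)
  | rightEnd

/-- The content of the input tape at position `k`, where `w` occupies the positions `1, …, |w|`. -/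
def inSymAt (w : List Bool) : ℕ → InSym
  | 0 => .leftEnd
  | k + 1 => (w[k]?).elim .rightEnd .bit

/-- One step of a transducer: next state, move of the input head, symbol to write and move on each
work tape, and possibly an output bit. -/
structure Action (Q Γ : Type) (k : ℕ) where
  state : Q
  inMove : Dir
  write : Fin k → Γ
  move : Fin k → Dir
  emit : Option Bool

/-- A deterministic Turing machine with a two-way read-only input tape, `k` one-way infinite work
tapes and a one-way write-only output tape. It halts where `δ` is undefined. -/
structure Transducer where
  Q : Type
  Γ : Type
  finQ : Finite Q
  finΓ : Finite Γ
  k : ℕ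
  start : Q
  blank : Γ
  δ : Q → InSym → (Fin k → Γ) → Option (Action Q Γ k)

namespace Transducer

structure Config (M : Transducer) where
  state : M.Q
  inPos : ℕ
  tape : Fin M.k → ℕ → M.Γ
  head : Fin M.k → ℕ
  out : List Bool

def initial (M : Transducer) : M.Config :=
  ⟨M.start, 0, fun _ _ => M.blank, fun _ => 0, []⟩

/-- The input head does not leave the positions `0, …, |w| + 1`; a head at position `0` that is to
move left stays where it is. -/
def step (M : Transducer) (w : List Bool) (c : M.Config) : Option M.Config :=
  (M.δ c.state (inSymAt w c.inPos) (fun t => c.tape t (c.head t))).map fun a =>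
    { state := a.state
      inPos := min (a.inMove.move c.inPos) (w.length + 1)
      tape := fun t => Function.update (c.tape t) (c.head t) (a.write t)
      head := fun t => (a.move t).move (c.head t)
      out := c.out ++ a.emit.toList }

def Reaches (M : Transducer) (w : List Bool) : M.Config → M.Config → Prop :=
  Relation.ReflTransGen fun c c' => M.step w c = some c'

/-- On every input `w` the machine halts with output `f w`. -/
def Computes (M : Transducer) (f : List Bool → List Bool) : Prop :=
  ∀ w, ∃ c, M.Reaches w M.initial c ∧ M.step w c = none ∧ c.out = f w

/-- On input `w` only `O(log |w|)` cells of the work tapes are visited. -/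
def IsLogspace (M : Transducer) : Prop :=
  ∃ K : ℕ, ∀ w c, M.Reaches w M.initial c → ∀ t, c.head t < K * (Nat.log 2 w.length + 1)

end Transducer

/-- `E` is a symbolic logspace graph encoding: a logspace transducer maps the binary encoding of
each recurrent circuit `D` to the binary encoding of `E D`. -/
def IsSymbolicLogspaceGraphEncoding {B A : Set (ℝ → ℝ)} (E : Circ B A → SymGraph) : Prop :=
  ∃ (M : Transducer) (f : List Bool → List Bool), M.IsLogspace ∧ M.Computes f ∧
    ∀ D, (E D).code = f D.code

/-! ### The complete bipartite encoding -/

/-- The complete bipartite graph between `n` input nodes labelled `in_1, …, in_n` and `m` output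
nodes labelled `1, …, m`. -/
def bipartite (n m : ℕ) : SymGraph where
  card := n + m
  graph :=
    { Adj := fun v w => (v.1 < n ∧ n ≤ w.1) ∨ (n ≤ v.1 ∧ w.1 < n)
      symm := ⟨fun _ _ h => h.elim (fun h => .inr ⟨h.2, h.1⟩) (fun h => .inl ⟨h.2, h.1⟩)⟩
      loopless := ⟨fun _ h => by omega⟩ }
  label := Fin.addCases (fun i : Fin n => .inp (i + 1)) (fun j : Fin m => .num (j + 1))
  valid v := by
    refine Fin.addCases (fun i => ?_) (fun j => ?_) v
    · simp only [Fin.addCases_left, Symbol.Valid]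
      omega
    · simp only [Fin.addCases_right, Symbol.Valid]
      omega

/-- The encoding of a recurrent circuit with `n` inputs and `m` outputs by a complete bipartite
graph. -/
def bipartiteEncoding {B A : Set (ℝ → ℝ)} (D : Circ B A) : SymGraph := bipartite D.n D.m

end RecGNN

/-! All output nodes see the same neighbours, the inputs `x`, and differ only in their own labels
`1, …, m`. What is needed is therefore a layer function `F` with `F (j, x) = f(x)_j` for `1 ≤ j ≤
m`. No comparison is required for this selection: the Lagrange polynomial through the points `(j,
f(x)_j)`, evaluated at the node's own label, does it (`nodeWeight_node`, `interpolateList_node`).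
For fixed `n` the number `m` of outputs is fixed, so the normalising factors are constants, and
gates of unbounded fan-in evaluate the polynomial with linearly many additional gates in constant
depth (`Circuit.select_outputs`, `Circuit.select_size_le`, `Circuit.select_depth_le`).

The construction is compatible with the recurrence: the new input feeds itself, and the old gates,
the halting gates among them, keep their values in every iteration (`RecCircuit.Mem.select`). Hence
the halting functions stay the same, and symmetry of `f` becomes tail symmetry of `F`
(`selectFun_mem_tailRecClass`). The index shift by one input is harmless for the bounds
(`IsFACBound.succ`).

For the logspace claim, the graph depends only on `n` and `m`, and the code of a circuit starts with
`1ⁿ 0 1ᵐ 0`. A two-way head on these two blocks and one counter bounded by the input length suffice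
to write the graph (`bipProgram_halts`). Such a counter, kept in binary on a work tape, takes
logarithmic space (`exists_logspace_transducer`). -/

namespace RecGNN

/-! ### Counter machines -/

/-- The instructions of a machine with a two-way read-only input tape, one counter and a write-only
output tape. -/
inductive CounterInstr (Q : Type) where
  | move (d : Dir) (e : Option Bool) (q : Q)
  | inc (d : Dir) (q : Q)
  | dec (succ zero : Q)

/-- A configuration of a counter machine. -/
structure CounterConfig (Q : Type) where
  state : Q
  inPos : ℕ
  count : ℕ
  out : List Bool

/-- The steps of a counter machine whose counter does not exceed the length of the input. -/
inductive CounterStep {Q : Type} (δ : Q → InSym → Option (CounterInstr Q)) (w : List Bool) :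
    CounterConfig Q → CounterConfig Q → Prop where
  | move {q p c o d e q'} (h : δ q (inSymAt w p) = some (.move d e q')) :
      CounterStep δ w ⟨q, p, c, o⟩ ⟨q', min (d.move p) (w.length + 1), c, o ++ e.toList⟩
  | inc {q p c o d q'} (h : δ q (inSymAt w p) = some (.inc d q')) (hc : c < w.length) :
      CounterStep δ w ⟨q, p, c, o⟩ ⟨q', min (d.move p) (w.length + 1), c + 1, o⟩
  | decSucc {q p c o q₁ q₂} (h : δ q (inSymAt w p) = some (.dec q₁ q₂)) :
      CounterStep δ w ⟨q, p, c + 1, o⟩ ⟨q₁, p, c, o⟩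
  | decZero {q p o q₁ q₂} (h : δ q (inSymAt w p) = some (.dec q₁ q₂)) :
      CounterStep δ w ⟨q, p, 0, o⟩ ⟨q₂, p, 0, o⟩

abbrev CounterReaches {Q : Type} (δ : Q → InSym → Option (CounterInstr Q)) (w : List Bool) :
    CounterConfig Q → CounterConfig Q → Prop :=
  Relation.ReflTransGen (CounterStep δ w)

/-- The machine halts on input `w` with output `o`. -/
def CounterHalts {Q : Type} (δ : Q → InSym → Option (CounterInstr Q)) (start : Q) (w o : List Bool) :
    Prop :=
  ∃ q p c, CounterReaches δ w ⟨start, 0, 0, []⟩ ⟨q, p, c, o⟩ ∧ δ q (inSymAt w p) = none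

/-! ### Binary counters -/

/-- The value of a binary number, least significant digit first. -/
def binVal : List Bool → ℕ
  | [] => 0
  | b :: l => b.toNat + 2 * binVal l

def binSucc : List Bool → List Bool
  | [] => [true]
  | false :: l => true :: l
  | true :: l => false :: binSucc l

/-- The number of digits is kept, so leading zeros may appear and no cell has to be erased. On a
number with value zero the borrow runs off the end and leaves only ones; the simulation detects this
and undoes it. -/
def binPred : List Bool → List Bool
  | [] => []
  | true :: l => false :: l
  | false :: l => true :: binPred l

theorem binVal_binSucc (l : List Bool) : binVal (binSucc l) = binVal l + 1 := by
  induction l with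
  | nil => rfl
  | cons b l ih => cases b <;> simp [binSucc, binVal, ih] <;> omega

theorem binVal_binPred (l : List Bool) : binVal (binPred l) = binVal l - 1 ∨ binVal l = 0 := by
  induction l with
  | nil => simp [binVal]
  | cons b l ih => cases b <;> simp only [binPred, binVal, Bool.toNat_true, Bool.toNat_false] <;> omega

theorem length_binPred (l : List Bool) : (binPred l).length = l.length := by
  induction l with
  | nil => rfl
  | cons b l ih => cases b <;> simp [binPred, ih]

/-- The successor gets a new digit only at powers of two. -/
theorem length_binSucc (l : List Bool) :
    (binSucc l).length = l.length ∨
      (binSucc l).length = l.length + 1 ∧ 2 ^ l.length = binVal l + 1 := by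
  induction l with
  | nil => simp [binSucc, binVal]
  | cons b l ih =>
    cases b
    · simp [binSucc]
    · simp only [binSucc, List.length_cons, binVal, Bool.toNat_true, pow_succ]
      omega

theorem eq_replicate_of_binVal_eq_zero {l : List Bool} (h : binVal l = 0) :
    l = List.replicate l.length false := by
  induction l with
  | nil => rfl
  | cons b l ih =>
    cases b
    · simp only [binVal, Bool.toNat_false] at h
      rw [List.length_cons, List.replicate_succ, ← ih (by omega)]
    · simp [binVal] at h

/-! ### Simulation by transducers -/

/-- What the simulating transducer is doing: it starts an instruction, or propagates a carry, or
propagates a borrow, or returns to the blank cell `0`, possibly resetting all digits. -/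
inductive CounterPhase where
  | run
  | carry
  | borrow
  | back
  | reset

theorem CounterPhase.finite : Finite CounterPhase :=
  Finite.of_surjective (fun k : Fin 5 => match k with
    | 0 => CounterPhase.run | 1 => .carry | 2 => .borrow | 3 => .back | 4 => .reset)
    fun ph => by
      cases ph
      exacts [⟨0, rfl⟩, ⟨1, rfl⟩, ⟨2, rfl⟩, ⟨3, rfl⟩, ⟨4, rfl⟩]

/-- One step on a single work tape with cells in `Option Bool`. -/
def counterAction {Q : Type} (δ : Q → InSym → Option (CounterInstr Q)) :
    CounterPhase × Q × Q → InSym → Option Bool →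
      Option ((CounterPhase × Q × Q) × Dir × Option Bool × Dir × Option Bool)
  | (.run, q, _), a, g =>
    match δ q a with
    | none => none
    | some (.move d e q') => some ((.run, q', q'), d, g, .stay, e)
    | some (.inc d q') => some ((.carry, q', q'), d, g, .right, none)
    -- Whether the counter is zero is known only after the borrow has found a one, so both target
    -- states are remembered. In the other phases the two components agree or only the first one is
    -- used.
    | some (.dec q₁ q₂) => some ((.borrow, q₁, q₂), .stay, g, .right, none)
  | (.carry, q), _, some true => some ((.carry, q), .stay, some false, .right, none)
  | (.carry, q), _, _ => some ((.back, q), .stay, some true, .left, none)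
  | (.borrow, q), _, some false => some ((.borrow, q), .stay, some true, .right, none)
  | (.borrow, q), _, some true => some ((.back, q), .stay, some false, .left, none)
  -- The borrow has passed all digits: the counter was zero. The second target is taken, and the
  -- ones left behind are turned back into zeros.
  | (.borrow, q), _, none => some ((.reset, q.2, q.2), .stay, none, .left, none)
  | (.back, q), _, some b => some ((.back, q), .stay, some b, .left, none)
  | (.back, q), _, none => some ((.run, q.1, q.1), .stay, none, .stay, none)
  | (.reset, q), _, some _ => some ((.reset, q), .stay, some false, .left, none)
  | (.reset, q), _, none => some ((.run, q.1, q.1), .stay, none, .stay, none)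

/-- The transducer that keeps the counter in binary on its work tape. -/
def counterTransducer {Q : Type} (hQ : Finite Q) (δ : Q → InSym → Option (CounterInstr Q))
    (start : Q) : Transducer where
  Q := CounterPhase × Q × Q
  Γ := Option Bool
  finQ := have := CounterPhase.finite; inferInstance
  finΓ := inferInstance
  k := 1
  start := (.run, start, start)
  blank := none
  δ s a g := (counterAction δ s a (g 0)).map fun r =>
    ⟨r.1, r.2.1, fun _ => r.2.2.1, fun _ => r.2.2.2.1, r.2.2.2.2⟩

/-- The work tape that holds the digits `l` from cell `1` on. -/
def counterTape (l : List Bool) : ℕ → Option Bool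
  | 0 => none
  | k + 1 => l[k]?

theorem update_counterTape (u v : List Bool) (b b' : Bool) :
    Function.update (counterTape (u ++ b :: v)) (u.length + 1) (some b') =
      counterTape (u ++ b' :: v) := by
  funext k
  rcases k with _ | k
  · simp [counterTape]
  · rcases lt_trichotomy k u.length with h | rfl | h
    · rw [Function.update_of_ne (by omega)]
      simp [counterTape, List.getElem?_append_left h]
    · simp [counterTape]
    · rw [Function.update_of_ne (by omega)]
      obtain ⟨j, rfl⟩ := Nat.exists_eq_add_of_lt h
      simp [counterTape, List.getElem?_append_right, Nat.add_assoc]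

theorem update_counterTape_end (u : List Bool) (b : Bool) :
    Function.update (counterTape u) (u.length + 1) (some b) = counterTape (u ++ [b]) := by
  funext k
  rcases k with _ | k
  · simp [counterTape]
  · rcases lt_trichotomy k u.length with h | rfl | h
    · rw [Function.update_of_ne (by omega)]
      simp [counterTape, List.getElem?_append_left h]
    · simp [counterTape]
    · rw [Function.update_of_ne (by omega)]
      simp [counterTape, h, h.le]

theorem counterTape_append (u v : List Bool) (b : Bool) :
    counterTape (u ++ b :: v) (u.length + 1) = some b := by
  simp [counterTape]

theorem counterTape_end (u : List Bool) : counterTape u (u.length + 1) = none := by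
  simp [counterTape]

/-! ### Transducer runs with bounded work heads -/

namespace Transducer

/-- Reachability through configurations all of whose work heads are below `B`. -/
abbrev ReachesBelow (M : Transducer) (w : List Bool) (B : ℕ) : M.Config → M.Config → Prop :=
  Relation.ReflTransGen fun c c' => M.step w c = some c' ∧ ∀ t, c.head t < B

theorem ReachesBelow.reaches {M : Transducer} {w : List Bool} {B : ℕ} {c c' : M.Config}
    (h : M.ReachesBelow w B c c') : M.Reaches w c c' :=
  Relation.ReflTransGen.mono (fun _ _ h => h.1) _ _ h

/-- The computation is deterministic, so a bounded halting computation bounds all reachable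
configurations. -/
theorem ReachesBelow.head_lt {M : Transducer} {w : List Bool} {B : ℕ} {c c' d : M.Config}
    (h : M.ReachesBelow w B c c') (hc' : M.step w c' = none) (hB : ∀ t, c'.head t < B)
    (hd : M.Reaches w c d) : ∀ t, d.head t < B := by
  induction h using Relation.ReflTransGen.head_induction_on with
  | refl =>
    rcases Relation.ReflTransGen.cases_head hd with rfl | ⟨e, he, -⟩
    · exact hB
    · rw [hc'] at he
      cases he
  | head h₁ _ ih =>
    rcases Relation.ReflTransGen.cases_head hd with rfl | ⟨e, he, hed⟩
    · exact h₁.2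
    · rw [h₁.1] at he
      cases he
      exact ih hed

end Transducer

section Simulation

variable {Q : Type} (hQ : Finite Q) (δ : Q → InSym → Option (CounterInstr Q)) (start : Q)

/-- The configurations of the simulating transducer. -/
def counterConf (s : CounterPhase × Q × Q) (p : ℕ) (T : ℕ → Option Bool) (h : ℕ) (o : List Bool) :
    (counterTransducer hQ δ start).Config :=
  ⟨s, p, fun _ => T, fun _ => h, o⟩

variable {δ}

theorem counterConf_step {w : List Bool} {s s' : CounterPhase × Q × Q} {p : ℕ}
    {T : ℕ → Option Bool} {h : ℕ} {o : List Bool} {d dm : Dir} {g e : Option Bool}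
    (H : counterAction δ s (inSymAt w p) (T h) = some (s', d, g, dm, e)) :
    (counterTransducer hQ δ start).step w (counterConf hQ δ start s p T h o) =
      some (counterConf hQ δ start s' (min (d.move p) (w.length + 1)) (Function.update T h g)
        (dm.move h) (o ++ e.toList)) := by
  simp only [Transducer.step, counterConf, counterTransducer, H, Option.map_some]

/-- A step that only concerns the work tape. -/
theorem counterConf_step_silent {w : List Bool} {s s' : CounterPhase × Q × Q} {p : ℕ}
    {T T' : ℕ → Option Bool} {h h' B : ℕ} {o : List Bool} {dm : Dir} {g : Option Bool}
    (hp : p ≤ w.length + 1) (hB : h < B)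
    (H : counterAction δ s (inSymAt w p) (T h) = some (s', .stay, g, dm, none))
    (hT : Function.update T h g = T') (hh : dm.move h = h') :
    (counterTransducer hQ δ start).step w (counterConf hQ δ start s p T h o) =
        some (counterConf hQ δ start s' p T' h' o) ∧
      ∀ t, (counterConf hQ δ start s p T h o).head t < B := by
  refine ⟨?_, fun _ => hB⟩
  rw [counterConf_step hQ start H]
  subst hh
  simp [hT, show Dir.stay.move p = p from rfl, hp]

/-- Cell `0` is the only blank cell at or below the head, so it serves as the left end marker. -/
theorem reaches_back {w : List Bool} {p : ℕ} (hp : p ≤ w.length + 1) (B : ℕ) (q : Q × Q)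
    (l : List Bool) (o : List Bool) (h : ℕ) (hl : h ≤ l.length) (hB : h < B) :
    (counterTransducer hQ δ start).ReachesBelow w B
      (counterConf hQ δ start (.back, q) p (counterTape l) h o)
      (counterConf hQ δ start (.run, q.1, q.1) p (counterTape l) 0 o) := by
  induction h with
  | zero =>
    exact .single (counterConf_step_silent hQ start hp hB (g := none) (dm := .stay) rfl
      (Function.update_eq_self _ _) rfl)
  | succ h ih =>
    refine .head ?_ (ih (by omega) (by omega))
    obtain ⟨b, hb⟩ : ∃ b, counterTape l (h + 1) = some b :=
      ⟨l[h], by simp [counterTape, List.getElem?_eq_getElem (show h < l.length by omega)]⟩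
    refine counterConf_step_silent hQ start hp hB (g := some b) (dm := .left) ?_ ?_ rfl
    · rw [hb]; rfl
    · rw [← hb, Function.update_eq_self]

/-- The list `u` holds the digits that the carry has already passed; generalising over it lets the
induction follow the head along the tape. -/
theorem reaches_carry {w : List Bool} {p : ℕ} (hp : p ≤ w.length + 1) (B : ℕ) (q : Q × Q)
    (o l : List Bool) (u : List Bool) (hB : (u ++ binSucc l).length < B) :
    (counterTransducer hQ δ start).ReachesBelow w B
      (counterConf hQ δ start (.carry, q) p (counterTape (u ++ l)) (u.length + 1) o)
      (counterConf hQ δ start (.run, q.1, q.1) p (counterTape (u ++ binSucc l)) 0 o) := by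
  induction l generalizing u with
  | nil =>
    simp only [binSucc, List.length_append, List.length_singleton] at hB
    refine .head (counterConf_step_silent hQ start hp hB (g := some true) (dm := .left)
      (by simp [counterTape_end, counterAction]) ?_ rfl) (reaches_back hQ start hp B q _ o _ ?_ ?_)
    · simp [update_counterTape_end, binSucc]
    · simp [Dir.move, binSucc]
    · simp only [Dir.move]; omega
  | cons b l ih =>
    cases b
    · simp only [binSucc, List.length_append, List.length_cons] at hB
      refine .head (counterConf_step_silent hQ start hp (by omega) (g := some true) (dm := .left)
        (by rw [counterTape_append]; rfl) (update_counterTape _ _ _ _) rfl)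
        (reaches_back hQ start hp B q _ o _ ?_ ?_)
      · simp [Dir.move]
      · simp only [Dir.move]; omega
    · simp only [binSucc, List.length_append, List.length_cons] at hB
      refine .head (counterConf_step_silent hQ start hp (by omega) (g := some false) (dm := .right)
        (by rw [counterTape_append]; rfl) (update_counterTape _ _ _ _) rfl) ?_
      simpa [binSucc, Dir.move] using ih (u ++ [false]) (by simp; omega)

/-- A nonzero value contains a one, which stops the borrow before it leaves the digits. -/
theorem reaches_borrow {w : List Bool} {p : ℕ} (hp : p ≤ w.length + 1) (B : ℕ) (q : Q × Q)
    (o l : List Bool) (hl : binVal l ≠ 0) (u : List Bool) (hB : (u ++ l).length < B) :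
    (counterTransducer hQ δ start).ReachesBelow w B
      (counterConf hQ δ start (.borrow, q) p (counterTape (u ++ l)) (u.length + 1) o)
      (counterConf hQ δ start (.run, q.1, q.1) p (counterTape (u ++ binPred l)) 0 o) := by
  induction l generalizing u with
  | nil => simp [binVal] at hl
  | cons b l ih =>
    simp only [List.length_append, List.length_cons] at hB
    cases b
    · refine .head (counterConf_step_silent hQ start hp (by omega) (g := some true) (dm := .right)
        (by rw [counterTape_append]; rfl) (update_counterTape _ _ _ _) rfl) ?_
      simpa [binPred, Dir.move] using
        ih (by simpa [binVal] using hl) (u ++ [true]) (by simp; omega)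
    · refine .head (counterConf_step_silent hQ start hp (by omega) (g := some false) (dm := .left)
        (by rw [counterTape_append]; rfl) (update_counterTape _ _ _ _) rfl)
        (reaches_back hQ start hp B q _ o _ ?_ ?_)
      · simp [Dir.move]
      · simp only [Dir.move]; omega

theorem reaches_reset {w : List Bool} {p : ℕ} (hp : p ≤ w.length + 1) (B : ℕ) (q : Q × Q)
    (o : List Bool) (j r : ℕ) (hB : j < B) :
    (counterTransducer hQ δ start).ReachesBelow w B
      (counterConf hQ δ start (.reset, q) p
        (counterTape (List.replicate j true ++ List.replicate r false)) j o)
      (counterConf hQ δ start (.run, q.1, q.1) p (counterTape (List.replicate (j + r) false)) 0 o) := by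
  induction j generalizing r with
  | zero =>
    simp only [List.replicate_zero, List.nil_append, Nat.zero_add]
    exact .single (counterConf_step_silent hQ start hp hB (g := none) (dm := .stay) rfl
      (Function.update_eq_self _ _) rfl)
  | succ j ih =>
    have e : List.replicate (j + 1) true ++ List.replicate r false =
        List.replicate j true ++ true :: List.replicate r false := by
      simp [List.replicate_succ']
    have h1 := counterTape_append (List.replicate j true) (List.replicate r false) true
    have h2 := update_counterTape (List.replicate j true) (List.replicate r false) true false
    rw [List.length_replicate] at h1 h2
    rw [e]
    refine .head (counterConf_step_silent hQ start hp (by omega) (g := some false) (dm := .left)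
        (by rw [h1]; rfl) h2 rfl) ?_
    have := ih (r + 1) (by omega)
    rwa [show j + (r + 1) = j + 1 + r by omega] at this

/-- The borrow has turned `j` zeros into ones and has `r` zeros still ahead. It reaches the blank
behind the last digit, and the reset restores all zeros on the way back. -/
theorem reaches_borrow_zero {w : List Bool} {p : ℕ} (hp : p ≤ w.length + 1) (B : ℕ) (q : Q × Q)
    (o : List Bool) (r j : ℕ) (hB : j + r + 1 < B) :
    (counterTransducer hQ δ start).ReachesBelow w B
      (counterConf hQ δ start (.borrow, q) p
        (counterTape (List.replicate j true ++ List.replicate r false)) (j + 1) o)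
      (counterConf hQ δ start (.run, q.2, q.2) p (counterTape (List.replicate (j + r) false)) 0 o) := by
  induction r generalizing j with
  | zero =>
    have h1 := counterTape_end (List.replicate j true)
    rw [List.length_replicate] at h1
    have := reaches_reset hQ start (δ := δ) hp B (q.2, q.2) o j 0 (by omega)
    simp only [List.replicate_zero, List.append_nil] at this ⊢
    refine .head (counterConf_step_silent hQ start hp (by omega) (g := none) (dm := .left)
        (by rw [h1]; rfl) ?_ rfl) this
    rw [← h1, Function.update_eq_self]
  | succ r ih =>
    have h1 := counterTape_append (List.replicate j true) (List.replicate r false) false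
    have h2 := update_counterTape (List.replicate j true) (List.replicate r false) false true
    rw [List.length_replicate] at h1 h2
    rw [List.replicate_succ]
    refine .head (counterConf_step_silent hQ start hp (by omega) (g := some true) (dm := .right)
        (by rw [h1]; rfl) h2 rfl) ?_
    have := ih (j + 1) (by omega)
    rw [show j + 1 + r = j + (r + 1) by omega] at this
    simpa [List.replicate_succ', Dir.move] using this

/-- The transducer configuration represents the configuration of the counter machine. -/
def Represents (w : List Bool) (c : CounterConfig Q) (C : (counterTransducer hQ δ start).Config) :
    Prop :=
  c.inPos ≤ w.length + 1 ∧ ∃ l, binVal l = c.count ∧ l.length ≤ Nat.log 2 w.length + 1 ∧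
    C = counterConf hQ δ start (.run, c.state, c.state) c.inPos (counterTape l) 0 c.out

/-- With at most `K = log |w| + 1` digits, the head gets at most to the blank cell `K + 1` behind
them, during a borrow from zero. The factor `3` makes `K + 1 < 3 * K` true even for `K = 1`. -/
theorem Represents.step {w : List Bool} {c c' : CounterConfig Q}
    {C : (counterTransducer hQ δ start).Config} (hC : Represents hQ start w c C)
    (h : CounterStep δ w c c') :
    ∃ C', Represents hQ start w c' C' ∧
      (counterTransducer hQ δ start).ReachesBelow w (3 * (Nat.log 2 w.length + 1)) C C' := by
  obtain ⟨hp, l, hl, hlen, rfl⟩ := hC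
  cases h with
  | @move q p c o d e q' h =>
    refine ⟨_, ⟨min_le_right _ _, l, hl, hlen, rfl⟩, .single ⟨?_, fun _ => by
      simp [counterConf]⟩⟩
    rw [counterConf_step hQ start (s' := (.run, q', q')) (d := d) (g := none) (dm := .stay) (e := e)]
    · rw [show (none : Option Bool) = counterTape l 0 from rfl, Function.update_eq_self]
      rfl
    · simp only [counterAction, h]
      rfl
  | @inc q p c o d q' h hc =>
    simp only at hl hp
    -- A new digit appears only if the new value is `2 ^ l.length`. This value is at most `|w|`, so
    -- the old length is at most `log |w|`.
    have hlen' : (binSucc l).length ≤ Nat.log 2 w.length + 1 := by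
      rcases length_binSucc l with h | ⟨h, h2⟩
      · omega
      · rw [h, Nat.succ_le_succ_iff]
        exact Nat.le_log_of_pow_le (by norm_num) (by omega)
    refine ⟨_, ⟨min_le_right _ _, binSucc l, by simp [binVal_binSucc, hl], hlen', rfl⟩,
      .head ⟨counterConf_step hQ start (s' := (.carry, q', q')) (d := d) (g := none) (dm := .right)
        (e := none) ?_, fun _ => by simp [counterConf]⟩ ?_⟩
    · simp only [counterAction, h]
      rfl
    · rw [show (none : Option Bool) = counterTape l 0 from rfl, Function.update_eq_self]
      simpa [Dir.move, counterTape] using reaches_carry hQ start (δ := δ) (w := w)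
        (p := min (d.move p) (w.length + 1)) (min_le_right _ _)
        (3 * (Nat.log 2 w.length + 1)) (q', q') o l [] (by simp; omega)
  | @decSucc q p c o q₁ q₂ h =>
    simp only at hl hp
    refine ⟨_, ⟨hp, binPred l, by have := binVal_binPred l; simp only; omega,
      by rw [length_binPred]; exact hlen, rfl⟩,
      .head (counterConf_step_silent hQ start hp (by omega) (s' := (.borrow, q₁, q₂)) (g := none)
        (dm := .right) ?_ (by
          rw [show (none : Option Bool) = counterTape l 0 from rfl, Function.update_eq_self]) rfl) ?_⟩
    · simp only [counterAction, h]
      rfl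
    · simpa [Dir.move] using reaches_borrow hQ start (δ := δ) hp
        (3 * (Nat.log 2 w.length + 1)) (q₁, q₂) o l (by omega) [] (by simp; omega)
  | @decZero q p o q₁ q₂ h =>
    simp only at hl hp
    have hl' := eq_replicate_of_binVal_eq_zero hl
    refine ⟨_, ⟨hp, l, hl, hlen, rfl⟩,
      .head (counterConf_step_silent hQ start hp (by omega) (s' := (.borrow, q₁, q₂)) (g := none)
        (dm := .right) ?_ (by
          rw [show (none : Option Bool) = counterTape l 0 from rfl, Function.update_eq_self]) rfl) ?_⟩
    · simp only [counterAction, h]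
      rfl
    · have := reaches_borrow_zero hQ start (δ := δ) hp
        (3 * (Nat.log 2 w.length + 1)) (q₁, q₂) o l.length 0 (by omega)
      simpa [Dir.move, ← hl'] using this

theorem Represents.reaches {w : List Bool} {c c' : CounterConfig Q}
    {C : (counterTransducer hQ δ start).Config} (hC : Represents hQ start w c C)
    (h : CounterReaches δ w c c') :
    ∃ C', Represents hQ start w c' C' ∧
      (counterTransducer hQ δ start).ReachesBelow w (3 * (Nat.log 2 w.length + 1)) C C' := by
  induction h with
  | refl => exact ⟨C, hC, .refl⟩
  | tail _ h ih =>
    obtain ⟨C₁, h₁, r₁⟩ := ih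
    obtain ⟨C₂, h₂, r₂⟩ := h₁.step hQ start h
    exact ⟨C₂, h₂, r₁.trans r₂⟩

theorem counterTransducer_halts {w o : List Bool} (h : CounterHalts δ start w o) :
    ∃ C, (counterTransducer hQ δ start).ReachesBelow w (3 * (Nat.log 2 w.length + 1))
        (counterTransducer hQ δ start).initial C ∧
      (counterTransducer hQ δ start).step w C = none ∧ C.out = o ∧
      ∀ t, C.head t < 3 * (Nat.log 2 w.length + 1) := by
  obtain ⟨q, p, c, hr, hn⟩ := h
  have h0 : Represents hQ start w ⟨start, 0, 0, []⟩ (counterTransducer hQ δ start).initial := by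
    -- The empty list of digits represents zero, and its tape is blank.
    refine ⟨Nat.zero_le _, [], rfl, Nat.zero_le _, ?_⟩
    have : counterTape [] = fun _ => none := by
      funext k
      cases k <;> simp [counterTape]
    rw [this]
    rfl
  obtain ⟨C, ⟨_, l, _, _, rfl⟩, hC⟩ := h0.reaches hQ start hr
  refine ⟨_, hC, ?_, rfl, fun _ => by simp [counterConf]⟩
  simp [Transducer.step, counterConf, counterTransducer, counterAction, hn]

/-- Functions computed by a counter machine with linearly bounded counter are computed by logspace
transducers. -/
theorem exists_logspace_transducer (hQ : Finite Q) (start : Q) {f : List Bool → List Bool}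
    (h : ∀ w, CounterHalts δ start w (f w)) : ∃ M : Transducer, M.IsLogspace ∧ M.Computes f := by
  refine ⟨counterTransducer hQ δ start, ⟨3, fun w c hc t => ?_⟩, fun w => ?_⟩
  · obtain ⟨C, h₁, h₂, -, h₄⟩ := counterTransducer_halts hQ start (h w)
    exact h₁.head_lt h₂ h₄ hc t
  · obtain ⟨C, h₁, h₂, h₃, -⟩ := counterTransducer_halts hQ start (h w)
    exact ⟨C, h₁.reaches, h₂, h₃⟩

end Simulation

/-! ### Loops of counter machines -/

section Loops

variable {Q : Type} {δ : Q → InSym → Option (CounterInstr Q)} {w : List Bool} {q q' : Q} {p c : ℕ}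
  {o : List Bool} {e : Option Bool}

theorem counterReaches_right (h : δ q (inSymAt w p) = some (.move .right e q'))
    (hp : p ≤ w.length) : CounterReaches δ w ⟨q, p, c, o⟩ ⟨q', p + 1, c, o ++ e.toList⟩ := by
  have := CounterStep.move (c := c) (o := o) h
  rw [show min (Dir.right.move p) (w.length + 1) = p + 1 by simp [Dir.move, hp]] at this
  exact .single this

theorem counterReaches_stay (h : δ q (inSymAt w p) = some (.move .stay e q'))
    (hp : p ≤ w.length + 1) : CounterReaches δ w ⟨q, p, c, o⟩ ⟨q', p, c, o ++ e.toList⟩ := by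
  have := CounterStep.move (c := c) (o := o) h
  rw [show min (Dir.stay.move p) (w.length + 1) = p by simp [Dir.move, hp]] at this
  exact .single this

/-- Walk to the right over ones, writing a bit for each. -/
theorem counterReaches_emit {b : Bool}
    (h : δ q (.bit true) = some (.move .right (some b) q)) (k : ℕ)
    (hw : ∀ j < k, inSymAt w (p + j) = .bit true) (hk : p + k ≤ w.length + 1) :
    CounterReaches δ w ⟨q, p, c, o⟩ ⟨q, p + k, c, o ++ List.replicate k b⟩ := by
  induction k with
  | zero => simpa using Relation.ReflTransGen.refl
  | succ k ih =>
    refine (ih (fun j hj => hw j (by omega)) (by omega)).trans ?_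
    have := counterReaches_right (c := c) (o := o ++ List.replicate k b) (p := p + k)
      (by rw [hw k (by omega)]; exact h) (by omega)
    rw [Nat.add_assoc] at this
    simpa [List.replicate_succ'] using this

/-- Walk to the right over ones. -/
theorem counterReaches_skip (h : δ q (.bit true) = some (.move .right none q)) (k : ℕ)
    (hw : ∀ j < k, inSymAt w (p + j) = .bit true) (hk : p + k ≤ w.length + 1) :
    CounterReaches δ w ⟨q, p, c, o⟩ ⟨q, p + k, c, o⟩ := by
  induction k with
  | zero => exact .refl
  | succ k ih =>
    refine (ih (fun j hj => hw j (by omega)) (by omega)).trans ?_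
    have := counterReaches_right (c := c) (o := o) (p := p + k)
      (by rw [hw k (by omega)]; exact h) (by omega)
    rw [Nat.add_assoc] at this
    simpa using this

/-- Walk to the right over ones, counting them. -/
theorem counterReaches_count (h : δ q (.bit true) = some (.inc .right q)) (k : ℕ)
    (hw : ∀ j < k, inSymAt w (p + j) = .bit true) (hk : p + k ≤ w.length + 1)
    (hc : c + k ≤ w.length) :
    CounterReaches δ w ⟨q, p, c, o⟩ ⟨q, p + k, c + k, o⟩ := by
  induction k with
  | zero => exact .refl
  | succ k ih =>
    refine (ih (fun j hj => hw j (by omega)) (by omega) (by omega)).tail ?_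
    have := CounterStep.inc (c := c + k) (o := o) (w := w) (p := p + k) (q := q) (δ := δ)
      (by rw [hw k (by omega)]; exact h) (by omega)
    rwa [show min (Dir.right.move (p + k)) (w.length + 1) = p + (k + 1) by
      simp only [Dir.move]; omega] at this

/-- Walk to the left over ones, counting them. -/
theorem counterReaches_count_left (h : δ q (.bit true) = some (.inc .left q)) (k : ℕ)
    (hw : ∀ j < k, inSymAt w (p + 1 + j) = .bit true) (hk : p + k ≤ w.length + 1)
    (hc : c + k ≤ w.length) :
    CounterReaches δ w ⟨q, p + k, c, o⟩ ⟨q, p, c + k, o⟩ := by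
  induction k generalizing c with
  | zero => exact .refl
  | succ k ih =>
    have := CounterStep.inc (c := c) (o := o) (w := w) (p := p + (k + 1)) (q := q) (δ := δ)
      (by rw [show p + (k + 1) = p + 1 + k by omega, hw k (by omega)]; exact h) (by omega)
    rw [show min (Dir.left.move (p + (k + 1))) (w.length + 1) = p + k by
      simp only [Dir.move]; omega] at this
    have h2 := ih (c := c + 1) (fun j hj => hw j (by omega)) (by omega) (by omega)
    rw [show c + 1 + k = c + (k + 1) by omega] at h2
    exact .head this h2

/-- Empty the counter, walking to the right and writing a one each time. -/
theorem counterReaches_uncount {q₁ : Q} (h : ∀ a, δ q a = some (.dec q₁ q'))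
    (h₁ : ∀ a, δ q₁ a = some (.move .right (some true) q)) (k : ℕ) (hk : p + k ≤ w.length + 1) :
    CounterReaches δ w ⟨q, p, k, o⟩ ⟨q', p + k, 0, o ++ List.replicate k true⟩ := by
  induction k generalizing p o with
  | zero => simpa using Relation.ReflTransGen.single (CounterStep.decZero (h _))
  | succ k ih =>
    refine .head (CounterStep.decSucc (h _)) ((counterReaches_right (h₁ _) (by omega)).trans ?_)
    have := ih (p := p + 1) (o := o ++ [true]) (by omega)
    rw [show p + 1 + k = p + (k + 1) by omega] at this
    simpa [List.replicate_succ] using this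

/-- Return to the left end. -/
theorem counterReaches_rewind (h : ∀ b, δ q (.bit b) = some (.move .left none q))
    (hp : p ≤ w.length) : CounterReaches δ w ⟨q, p, c, o⟩ ⟨q, 0, c, o⟩ := by
  induction p with
  | zero => exact .refl
  | succ p ih =>
    have := CounterStep.move (δ := δ) (w := w) (q := q) (p := p + 1) (c := c) (o := o)
      (d := .left) (e := none) (q' := q) (by
        simp only [inSymAt, List.getElem?_eq_getElem (show p < w.length by omega)]
        exact h _)
    rw [show min (Dir.left.move (p + 1)) (w.length + 1) = p by
      simp only [Dir.move]; omega] at this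
    refine .head this ?_
    simpa using ih (by omega)

end Loops

/-! ### A counter machine that writes complete bipartite graphs -/

/-- The control states. The flag tells whether the machine treats inputs or outputs. -/
inductive BipState where
  | start
  | scanIn
  | scanOut
  | skip
  | labels
  | rewind (b : Bool)
  | load (b : Bool)
  | home (b : Bool)
  | row (b : Bool)
  | rowIn (b : Bool)
  | rowOut (b : Bool)
  | label (b : Bool)
  | tag (b : Bool)
  | down (b : Bool)
  | up (b : Bool)
  | digit (b : Bool)
  | close (b : Bool)

theorem BipState.finite : Finite BipState := by
  have h : (Set.univ : Set BipState) = {start, scanIn, scanOut, skip, labels} ∪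
      ⋃ b : Bool, {rewind b, load b, home b, row b, rowIn b, rowOut b, label b, tag b, down b, up b,
        digit b, close b} := by
    ext s
    cases s <;> simp
  rw [← Set.finite_univ_iff, h]
  exact (Set.toFinite _).union (Set.finite_iUnion fun _ => Set.toFinite _)

/-- First the number of nodes is written, scanning the input `1ⁿ 0 1ᵐ 0 …`. Then for each of the two
classes of nodes the counter is loaded with its cardinality, and decremented for each written row of
the adjacency matrix. Finally each position of the two blocks of ones contributes a label, where the
counter keeps the distance to the beginning of the block. -/
def bipProgram : BipState → InSym → Option (CounterInstr BipState)
  | .start, _ => some (.move .right none .scanIn)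
  | .scanIn, .bit true => some (.move .right (some true) .scanIn)
  | .scanIn, .bit false => some (.move .right none .scanOut)
  | .scanIn, _ => none
  | .scanOut, .bit true => some (.move .right (some true) .scanOut)
  | .scanOut, .bit false => some (.move .stay (some false) (.rewind false))
  | .scanOut, _ => none
  | .rewind b, .leftEnd => some (.move .right none (if b then .skip else .load false))
  | .rewind b, _ => some (.move .left none (.rewind b))
  | .skip, .bit true => some (.move .right none .skip)
  | .skip, _ => some (.move .right none (.load true))
  | .load b, .bit true => some (.inc .right (.load b))
  | .load b, _ => some (.move .stay none (.home b))
  | .home b, .leftEnd => some (.dec (.row b) (if b then .labels else .rewind true))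
  | .home b, _ => some (.move .left none (.home b))
  | .row b, _ => some (.move .right none (.rowIn b))
  -- In the row of an input node (`b = false`) the input columns are `0` and the output columns `1`;
  -- for an output node it is the other way round.
  | .rowIn b, .bit true => some (.move .right (some b) (.rowIn b))
  | .rowIn b, _ => some (.move .right none (.rowOut b))
  | .rowOut b, .bit true => some (.move .right (some !b) (.rowOut b))
  | .rowOut b, _ => some (.move .stay none (.home b))
  | .labels, _ => some (.move .right none (.label false))
  -- The codes of `inp` and `num` start with `00` and `11`, that is, with two copies of the flag.
  | .label b, .bit true => some (.move .stay (some b) (.tag b))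
  | .label b, _ => if b then none else some (.move .right none (.label true))
  | .tag b, _ => some (.move .stay (some b) (.down b))
  | .down b, .bit true => some (.inc .left (.down b))
  | .down b, _ => some (.move .stay none (.up b))
  -- Emptying the counter while walking right writes the unary label and also brings the head back
  -- to the cell where the walk to the left began.
  | .up b, _ => some (.dec (.digit b) (.close b))
  | .digit b, _ => some (.move .right (some true) (.up b))
  | .close b, _ => some (.move .right (some false) (.label b))

/-! ### Reading the input `1ⁿ 0 1ᵐ 0 …` and correctness of the program -/

theorem inSymAt_one (n : ℕ) (s : List Bool) (j : ℕ) (hj : j < n) :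
    inSymAt (List.replicate n true ++ s) (1 + j) = .bit true := by
  rw [Nat.add_comm]
  simp [inSymAt, List.getElem?_append_left, hj]

theorem inSymAt_length (u s : List Bool) (j : ℕ) :
    inSymAt (u ++ s) (u.length + 1 + j) = inSymAt s (1 + j) := by
  rw [show u.length + 1 + j = u.length + j + 1 by omega, Nat.add_comm 1 j]
  simp [inSymAt, List.getElem?_append_right]

section Correctness

variable {w s : List Bool} {n m c p : ℕ} {o : List Bool} {b : Bool}

theorem inSymAt_in (hw : w = unary n ++ unary m ++ s) (j : ℕ) (hj : j < n) :
    inSymAt w (1 + j) = .bit true := by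
  rw [hw, unary, List.append_assoc, List.append_assoc]
  exact inSymAt_one n _ j hj

theorem inSymAt_in_end (hw : w = unary n ++ unary m ++ s) : inSymAt w (1 + n) = .bit false := by
  have := inSymAt_length (List.replicate n true) ([false] ++ unary m ++ s) 0
  rw [hw, unary, List.append_assoc, List.append_assoc, ← List.append_assoc [false], Nat.add_comm 1]
  rw [List.length_replicate] at this
  exact this

theorem inSymAt_out (hw : w = unary n ++ unary m ++ s) (j : ℕ) (hj : j < m) :
    inSymAt w (n + 2 + j) = .bit true := by
  have := inSymAt_length (unary n) (unary m ++ s) j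
  rw [hw, List.append_assoc]
  rw [show (unary n).length = n + 1 by simp [unary]] at this
  rw [this, unary, List.append_assoc]
  exact inSymAt_one m _ j hj

theorem inSymAt_out_end (hw : w = unary n ++ unary m ++ s) :
    inSymAt w (n + 2 + m) = .bit false := by
  have := inSymAt_length (unary n ++ List.replicate m true) ([false] ++ s) 0
  rw [show (unary n ++ List.replicate m true).length + 1 + 0 = n + 2 + m by simp [unary]; omega]
    at this
  rw [hw, show unary m = List.replicate m true ++ [false] from rfl, ← List.append_assoc,
    List.append_assoc, this]
  rfl

theorem le_length_of_eq (hw : w = unary n ++ unary m ++ s) : n + 2 + m ≤ w.length := by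
  simp [hw, unary]
  omega

/-- Write the rows of one class of nodes. -/
theorem bipProgram_rows (hw : w = unary n ++ unary m ++ s) (hp : p ≤ w.length) :
    CounterReaches bipProgram w ⟨.home b, p, c, o⟩
      ⟨if b then .labels else .rewind true, 0, 0,
        o ++ (List.replicate c (List.replicate n b ++ List.replicate m !b)).flatten⟩ := by
  have hlen := le_length_of_eq hw
  induction c generalizing p o with
  | zero =>
    refine (counterReaches_rewind (fun _ => rfl) hp).trans ?_
    simpa using Relation.ReflTransGen.single
      (CounterStep.decZero (δ := bipProgram) (w := w) (p := 0) (o := o) (q := .home b) rfl)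
  | succ c ih =>
    refine (counterReaches_rewind (fun _ => rfl) hp).trans
      (.head (CounterStep.decSucc (q₁ := .row b) rfl) ?_)
    refine (counterReaches_right (q' := .rowIn b) (e := none) rfl (by omega)).trans ?_
    refine (counterReaches_emit (b := b) rfl n (by simpa using inSymAt_in hw) (by omega)).trans ?_
    refine (counterReaches_right (q' := .rowOut b) (e := none) (by
      rw [Nat.zero_add, inSymAt_in_end hw]; rfl) (by omega)).trans ?_
    rw [show 0 + 1 + n + 1 = n + 2 by omega]
    refine (counterReaches_emit (b := !b) rfl m (inSymAt_out hw) (by omega)).trans ?_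
    refine (counterReaches_stay (q' := .home b) (e := none) (by
      rw [inSymAt_out_end hw]; rfl) (by omega)).trans ?_
    simpa [List.replicate_succ] using ih (p := n + 2 + m)
      (o := o ++ List.replicate n b ++ List.replicate m !b) (by omega)

/-- Write the labels of one class of nodes, that is, of a block of `k` ones after position `p`. -/
theorem bipProgram_labels (k i : ℕ) (hk : p + k + i ≤ w.length)
    (h₀ : inSymAt w p ≠ .bit true) (h₁ : ∀ j < k + i, inSymAt w (p + 1 + j) = .bit true) :
    CounterReaches bipProgram w ⟨.label b, p + 1 + i, 0, o⟩
      ⟨.label b, p + 1 + (k + i), 0,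
        o ++ (List.range' i k).flatMap fun j => [b, b] ++ unary (j + 1)⟩ := by
  induction k generalizing i o with
  | zero => simpa using Relation.ReflTransGen.refl
  | succ k ih =>
    refine (counterReaches_stay (e := some b) (q' := .tag b) (by
      rw [h₁ i (by omega)]; rfl) (by omega)).trans ?_
    refine (counterReaches_stay (e := some b) (q' := .down b) rfl (by omega)).trans ?_
    -- The current cell lies `i + 1` cells to the right of the delimiter at `p`, so the walk to the
    -- left counts exactly the index of the label, which starts from `1`.
    rw [show p + 1 + i = p + (i + 1) by omega]
    refine (counterReaches_count_left rfl (i + 1) (fun j hj => h₁ j (by omega)) (by omega)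
      (by omega)).trans ?_
    refine (counterReaches_stay (e := none) (q' := .up b) ?_ (by omega)).trans ?_
    · cases h : inSymAt w p with
      | leftEnd => rfl
      | rightEnd => rfl
      | bit a =>
        cases a
        · rfl
        · exact (h₀ h).elim
    rw [Nat.zero_add]
    refine (counterReaches_uncount (q₁ := .digit b) (q' := .close b) (fun _ => rfl) (fun _ => rfl)
      (i + 1) (by omega)).trans ?_
    refine (counterReaches_right (e := some false) (q' := .label b) rfl (by omega)).trans ?_
    have := ih (i + 1) (o := o ++ ([b, b] ++ unary (i + 1))) (by omega)
      (fun j hj => h₁ j (by omega))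
    rw [show k + (i + 1) = k + 1 + i by omega] at this
    rw [show p + (i + 1) + 1 = p + 1 + (i + 1) by omega]
    simpa [List.range'_succ, unary] using this

/-- The output on inputs that start with `1ⁿ 0 1ᵐ 0`. -/
def bipOutput (n m : ℕ) : List Bool :=
  unary (n + m) ++ (List.replicate n (List.replicate n false ++ List.replicate m true)).flatten ++
    (List.replicate m (List.replicate n true ++ List.replicate m false)).flatten ++
    ((List.range' 0 n).flatMap fun j => [false, false] ++ unary (j + 1)) ++
    (List.range' 0 m).flatMap fun j => [true, true] ++ unary (j + 1)

theorem bipProgram_halts (n m : ℕ) (s : List Bool) :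
    CounterHalts bipProgram .start (unary n ++ unary m ++ s) (bipOutput n m) := by
  generalize hw : unary n ++ unary m ++ s = w
  replace hw := hw.symm
  have hlen := le_length_of_eq hw
  -- Position `0` is the left end marker, so the blocks of ones occupy `1, …, n` and `n + 2, …, n +
  -- 1 + m`. The machine halts on the zero behind the second block.
  refine ⟨.label true, n + 2 + m, 0, ?_, by rw [inSymAt_out_end hw]; rfl⟩
  refine (counterReaches_right (q' := .scanIn) (e := none) rfl (by omega)).trans ?_
  rw [Nat.zero_add]
  refine (counterReaches_emit (b := true) rfl n (inSymAt_in hw) (by omega)).trans ?_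
  refine (counterReaches_right (q' := .scanOut) (e := none) (by
    rw [inSymAt_in_end hw]; rfl) (by omega)).trans ?_
  rw [show 1 + n + 1 = n + 2 by omega]
  refine (counterReaches_emit (b := true) rfl m (inSymAt_out hw) (by omega)).trans ?_
  refine (counterReaches_stay (q' := .rewind false) (e := some false) (by
    rw [inSymAt_out_end hw]; rfl) (by omega)).trans ?_
  refine (counterReaches_rewind (fun _ => rfl) (by omega)).trans ?_
  refine (counterReaches_right (q' := .load false) (e := none) rfl (by omega)).trans ?_
  rw [Nat.zero_add]
  refine (counterReaches_count rfl n (inSymAt_in hw) (by omega) (by omega)).trans ?_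
  refine (counterReaches_stay (q' := .home false) (e := none) (by
    rw [inSymAt_in_end hw]; rfl) (by omega)).trans ?_
  refine (bipProgram_rows hw (by omega)).trans ?_
  rw [if_neg Bool.false_ne_true, Nat.zero_add]
  refine (counterReaches_right (q' := .skip) (e := none) rfl (by omega)).trans ?_
  rw [Nat.zero_add]
  refine (counterReaches_skip rfl n (inSymAt_in hw) (by omega)).trans ?_
  refine (counterReaches_right (q' := .load true) (e := none) (by
    rw [inSymAt_in_end hw]; rfl) (by omega)).trans ?_
  rw [show 1 + n + 1 = n + 2 by omega]
  refine (counterReaches_count rfl m (inSymAt_out hw) (by omega) (by omega)).trans ?_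
  refine (counterReaches_stay (q' := .home true) (e := none) (by
    rw [inSymAt_out_end hw]; rfl) (by omega)).trans ?_
  refine (bipProgram_rows hw (by omega)).trans ?_
  rw [if_pos rfl, Nat.zero_add]
  refine (counterReaches_right (q' := .label false) (e := none) rfl (by omega)).trans ?_
  refine (bipProgram_labels (p := 0) n 0 (by omega) (by simp [inSymAt])
    (by simpa using inSymAt_in hw)).trans ?_
  refine (counterReaches_right (q' := .label true) (e := none) (by
    simp only [Nat.add_zero, Nat.zero_add]; rw [inSymAt_in_end hw]; rfl) (by omega)).trans ?_
  -- The delimiter of the second block is the zero at `n + 1`; for the first block it was the left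
  -- end marker.
  have := bipProgram_labels (w := w) (p := 1 + n) (b := true)
    (o := unary (n + m) ++
      (List.replicate n (List.replicate n false ++ List.replicate m true)).flatten ++
      (List.replicate m (List.replicate n true ++ List.replicate m false)).flatten ++
      (List.range' 0 n).flatMap fun j => [false, false] ++ unary (j + 1))
    m 0 (by omega) (by rw [inSymAt_in_end hw]; simp)
    (by simpa [show 1 + n + 1 = n + 2 by omega] using inSymAt_out hw)
  simp only [Nat.add_zero, Nat.zero_add] at this ⊢
  rw [show 1 + n + 1 + m = n + 2 + m by omega] at this
  simpa only [bipOutput, unary, List.replicate_add, List.append_assoc, List.nil_append,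
    Option.toList_none, Option.toList_some, Bool.not_false, Bool.not_true, List.append_nil] using this

/-- The program halts on malformed inputs too. -/
theorem bipProgram_halts_of_not (w : List Bool) (hw : ¬ ∃ n m s, w = unary n ++ unary m ++ s) :
    ∃ o, CounterHalts bipProgram .start w o := by
  -- A word either consists of ones only or starts with a unary code. On a malformed input one of
  -- the two initial scans thus runs into the right end marker, where the program stops.
  have key : ∀ w : List Bool, (∃ n, w = List.replicate n true) ∨ ∃ n s, w = unary n ++ s := by
    intro w
    induction w with
    | nil => exact .inl ⟨0, rfl⟩
    | cons b w ih =>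
      cases b
      · exact .inr ⟨0, w, rfl⟩
      · rcases ih with ⟨n, rfl⟩ | ⟨n, s, rfl⟩
        · exact .inl ⟨n + 1, rfl⟩
        · exact .inr ⟨n + 1, s, rfl⟩
  rcases key w with ⟨n, rfl⟩ | ⟨n, s, rfl⟩
  · refine ⟨[] ++ List.replicate n true, .scanIn, 1 + n, 0, ?_, ?_⟩
    · refine (counterReaches_right (q' := .scanIn) (e := none) rfl (by omega)).trans ?_
      exact counterReaches_emit (b := true) rfl n
        (fun j hj => by simpa using inSymAt_one n [] j hj) (by simp; omega)
    · rw [Nat.add_comm]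
      simp [inSymAt, bipProgram]
  · rcases key s with ⟨m, rfl⟩ | ⟨m, s, rfl⟩
    · have hl : (unary n).length = n + 1 := by simp [unary]
      refine ⟨List.replicate n true ++ List.replicate m true, .scanOut, n + 2 + m, 0, ?_, ?_⟩
      · refine (counterReaches_right (q' := .scanIn) (e := none) rfl (by omega)).trans ?_
        refine (counterReaches_emit (b := true) rfl n
          (fun j hj => ?_) (by simp [hl]; omega)).trans ?_
        · simpa [unary] using inSymAt_one n ([false] ++ List.replicate m true) j hj
        refine (counterReaches_right (q' := .scanOut) (e := none) ?_ (by simp [hl]; omega)).trans ?_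
        · have := inSymAt_length (List.replicate n true) ([false] ++ List.replicate m true) 0
          rw [List.length_replicate, ← List.append_assoc] at this
          rw [show 0 + 1 + n = n + 1 + 0 by omega, unary, this]
          rfl
        rw [show 0 + 1 + n + 1 = n + 2 by omega]
        simpa using counterReaches_emit (δ := bipProgram) (q := .scanOut) (p := n + 2) (c := 0)
          (o := List.replicate n true) (w := unary n ++ List.replicate m true) (b := true) rfl m
          (fun j hj => by
            have := inSymAt_length (unary n) (List.replicate m true) j
            rw [hl] at this
            rw [this]
            simpa using inSymAt_one m [] j hj) (by simp [hl]; omega)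
      · have := inSymAt_length (unary n) (List.replicate m true) m
        rw [hl] at this
        rw [this, Nat.add_comm]
        simp [inSymAt, bipProgram]
    · exact (hw ⟨n, m, s, by simp⟩).elim

end Correctness

/-! ### The code of the complete bipartite graph -/

theorem finRange_add_flatMap {β : Type} (n m : ℕ) (g : Fin (n + m) → List β) :
    (List.finRange (n + m)).flatMap g =
      ((List.finRange n).flatMap fun i => g (Fin.castAdd m i)) ++
        (List.finRange m).flatMap fun j => g (Fin.natAdd n j) := by
  rw [← List.ofFn_id (n := n + m), List.ofFn_add, List.flatMap_append]
  simp only [List.ofFn_eq_map, List.flatMap_map, id]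
  rfl

theorem finRange_flatMap_val {β : Type} (n : ℕ) (g : ℕ → List β) :
    ((List.finRange n).flatMap fun i : Fin n => g i.1) = (List.range' 0 n).flatMap g := by
  rw [← List.range_eq_range', ← List.map_coe_finRange_eq_range, List.flatMap_map]

theorem finRange_flatMap_const {β : Type} (n : ℕ) (u : List β) :
    ((List.finRange n).flatMap fun _ => u) = (List.replicate n u).flatten := by
  rw [List.flatMap_def, List.map_const', List.length_finRange]

theorem finRange_add_map {β : Type} (n m : ℕ) (g : Fin (n + m) → β) :
    (List.finRange (n + m)).map g =
      ((List.finRange n).map fun i => g (Fin.castAdd m i)) ++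
        (List.finRange m).map fun j => g (Fin.natAdd n j) := by
  rw [← List.ofFn_eq_map, List.ofFn_add, List.ofFn_eq_map, List.ofFn_eq_map]
  rfl

theorem code_bipartite (n m : ℕ) : (bipartite n m).code = bipOutput n m := by
  have hcode : (bipartite n m).code = unary (n + m) ++
      ((List.finRange (n + m)).flatMap fun v => (List.finRange (n + m)).map fun w =>
        decide ((v.1 < n ∧ n ≤ w.1) ∨ (n ≤ v.1 ∧ w.1 < n))) ++
      (List.finRange (n + m)).flatMap fun v => (Fin.addCases (fun i : Fin n => Symbol.inp (i + 1))
        (fun j : Fin m => .num (j + 1)) v : Symbol).code := by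
    simp only [SymGraph.code]
    change unary (n + m) ++ ((List.finRange (n + m)).flatMap fun v : Fin (n + m) =>
      (List.finRange (n + m)).map fun w : Fin (n + m) =>
        @decide ((v.1 < n ∧ n ≤ w.1) ∨ (n ≤ v.1 ∧ w.1 < n)) (Classical.propDecidable _)) ++
      ((List.finRange (n + m)).flatMap fun v => (Fin.addCases (fun i : Fin n => Symbol.inp (i + 1))
        (fun j : Fin m => .num (j + 1)) v : Symbol).code) = _
    -- Only the decidability instances differ: `SymGraph.code` decides adjacency classically.
    congr!
  have hrow : ∀ v : Fin (n + m), ((List.finRange (n + m)).map fun w =>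
      decide ((v.1 < n ∧ n ≤ w.1) ∨ (n ≤ v.1 ∧ w.1 < n))) =
        List.replicate n (decide (n ≤ v.1)) ++ List.replicate m (decide (v.1 < n)) := by
    intro v
    rw [finRange_add_map]
    congr 1 <;> simp [List.eq_replicate_iff]
  simp only [hcode, hrow, finRange_add_flatMap, bipOutput, ← finRange_flatMap_val]
  have hlt : ∀ i : Fin n, ¬ n ≤ i.1 := fun i => by omega
  simp [finRange_flatMap_const, Symbol.code, hlt]

/-- The transducer has to halt within its space bound on every word, hence the separate treatment of
words that are no codes. On codes the output is well defined because unary codes are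
self-delimiting, so that the word determines `n` and `m`. -/
theorem isSymbolicLogspaceGraphEncoding_bipartiteEncoding {B A : Set (ℝ → ℝ)} :
    IsSymbolicLogspaceGraphEncoding (bipartiteEncoding : Circ B A → SymGraph) := by
  have key : ∀ w : List Bool, ∃ o, CounterHalts bipProgram .start w o ∧
      ∀ n m s, w = unary n ++ unary m ++ s → o = bipOutput n m := by
    intro w
    by_cases hw : ∃ n m s, w = unary n ++ unary m ++ s
    · obtain ⟨n, m, s, rfl⟩ := hw
      refine ⟨_, bipProgram_halts n m s, fun n' m' s' h => ?_⟩
      simp only [List.append_assoc] at h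
      obtain ⟨hn, h⟩ := unary_append_inj h
      rw [hn, (unary_append_inj h).1]
    · obtain ⟨o, ho⟩ := bipProgram_halts_of_not w hw
      exact ⟨o, ho, fun n m s h => (hw ⟨n, m, s, h⟩).elim⟩
  choose f hf hf' using key
  obtain ⟨M, h₁, h₂⟩ := exists_logspace_transducer BipState.finite .start hf
  refine ⟨M, f, h₁, h₂, fun D => ?_⟩
  rw [bipartiteEncoding, code_bipartite]
  -- The rest of the code behind the two unary numbers is left open; the closing `rfl` determines
  -- it.
  refine (hf' _ D.n D.m ?_ ?_).symm
  rotate_left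
  · simp only [Circ.code, Circuit.code, List.append_assoc]
    rfl

/-! ### Selection by interpolation -/

/-- The polynomial in `c` that is `1` at `j + 1` and `0` at the other nodes among `1, …, m`. -/
noncomputable def nodeWeight (m : ℕ) (c : ℝ) (j : Fin m) : ℝ :=
  -- The shape is that of the circuit: the inverse is one constant, and each factor is the value of
  -- an addition gate with a negative constant. The difference of the nodes `j + 1` and `k + 1` is
  -- `j - k`.
  (∏ k ∈ Finset.univ.erase j, ((j : ℝ) - k))⁻¹ * ∏ k ∈ Finset.univ.erase j, (c + -((k : ℝ) + 1))

theorem nodeWeight_node (m : ℕ) (i j : Fin m) :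
    nodeWeight m ((i : ℝ) + 1) j = if j = i then 1 else 0 := by
  unfold nodeWeight
  split_ifs with h
  · subst h
    have h0 : ∏ k ∈ Finset.univ.erase j, ((j : ℝ) - k) ≠ 0 := by
      refine Finset.prod_ne_zero_iff.2 fun k hk => ?_
      rw [sub_ne_zero, Ne, Nat.cast_inj, Fin.val_inj]
      exact (Finset.ne_of_mem_erase hk).symm
    refine Eq.trans ?_ (inv_mul_cancel₀ h0)
    congr 1
    exact Finset.prod_congr rfl fun k _ => by ring
  · have h0 : ∏ k ∈ Finset.univ.erase j, ((i : ℝ) + 1 + -((k : ℝ) + 1)) = 0 :=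
      Finset.prod_eq_zero (i := i) (by simp [Ne.symm h]) (by ring)
    rw [h0, mul_zero]

/-- The length of `List.ofFn o` equals `m` only propositionally, so the index has to be transported.
-/
theorem nodeWeight_cast {m m' : ℕ} (h : m = m') (c : ℝ) (j : Fin m) :
    nodeWeight m c j = nodeWeight m' c (Fin.cast h j) := by
  subst h
  rfl

/-- The value at `c` of the interpolation polynomial with the values `u` at `1, …, |u|`. -/
noncomputable def interpolateList (c : ℝ) (u : List ℝ) : ℝ :=
  ∑ j : Fin u.length, u.get j * nodeWeight u.length c j

theorem interpolateList_ofFn {m : ℕ} (c : ℝ) (o : Fin m → ℝ) :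
    interpolateList c (List.ofFn o) = ∑ j, o j * nodeWeight m c j := by
  refine Fintype.sum_equiv (finCongr (List.length_ofFn)) _ _ fun j => ?_
  rw [nodeWeight_cast List.length_ofFn, List.get_ofFn]
  rfl

theorem interpolateList_node {m : ℕ} (o : Fin m → ℝ) (i : Fin m) :
    interpolateList ((i : ℝ) + 1) (List.ofFn o) = o i := by
  simp [interpolateList_ofFn, nodeWeight_node]

/-! ### The selection circuit -/

/-- The gates of a circuit that interpolates the outputs of a circuit with gates `G`. -/
inductive SelectGate (G : Type) (m : ℕ) where
  | old (g : G)
  | arg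
  | node (k : Fin m)
  | diff (k : Fin m)
  | coef (k : Fin m)
  | term (k : Fin m)
  | sum
  | out

namespace SelectGate

variable {G : Type} {m : ℕ}

def equivSum : SelectGate G m ≃ G ⊕ (Fin 4 × Fin m) ⊕ Fin 3 where
  toFun
    | old g => .inl g
    | node k => .inr (.inl (0, k))
    | diff k => .inr (.inl (1, k))
    | coef k => .inr (.inl (2, k))
    | term k => .inr (.inl (3, k))
    | arg => .inr (.inr 0)
    | sum => .inr (.inr 1)
    | out => .inr (.inr 2)
  invFun
    | .inl g => old g
    | .inr (.inl (0, k)) => node k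
    | .inr (.inl (1, k)) => diff k
    | .inr (.inl (2, k)) => coef k
    | .inr (.inl (3, k)) => term k
    | .inr (.inr 0) => arg
    | .inr (.inr 1) => sum
    | .inr (.inr 2) => out
  left_inv s := by cases s <;> rfl
  right_inv s := by
    rcases s with g | ⟨a, k⟩ | a
    · rfl
    · fin_cases a <;> rfl
    · fin_cases a <;> rfl

def oldEmb : G ↪ SelectGate G m := ⟨old, fun _ _ h => old.inj h⟩

def diffEmb : Fin m ↪ SelectGate G m := ⟨diff, fun _ _ h => diff.inj h⟩

def termEmb : Fin m ↪ SelectGate G m := ⟨term, fun _ _ h => term.inj h⟩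

theorem oldEmb_apply (g : G) : (oldEmb g : SelectGate G m) = old g := rfl

theorem diffEmb_apply (k : Fin m) : (diffEmb k : SelectGate G m) = diff k := rfl

theorem termEmb_apply (k : Fin m) : (termEmb k : SelectGate G m) = term k := rfl

end SelectGate

namespace GateKind

/-- The kind of a gate after a new first input has been added and the outputs have been replaced by
addition gates. -/
def lift {n l m : ℕ} : GateKind n l m → GateKind (n + 1) l 1
  | .input i => .input i.succ
  | .aux i => .aux i
  -- An output gate has one predecessor, so as an addition gate it keeps its value, and it may now
  -- have successors.
  | .output _ => .add
  | .const c => .const c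
  | .add => .add
  | .mul => .mul
  | .func f => .func f

theorem lift_eq_input {n l m : ℕ} {t : GateKind n l m} {i : Fin (n + 1)} :
    t.lift = .input i ↔ ∃ j : Fin n, j.succ = i ∧ t = .input j := by
  cases t <;> simp [lift]

theorem lift_eq_aux {n l m : ℕ} {t : GateKind n l m} {i : Fin l} :
    t.lift = .aux i ↔ t = .aux i := by
  cases t <;> simp [lift]

theorem lift_eq_const {n l m : ℕ} {t : GateKind n l m} {c : ℝ} :
    t.lift = .const c ↔ t = .const c := by
  cases t <;> simp [lift]

theorem lift_eq_func {n l m : ℕ} {t : GateKind n l m} {f : ℝ → ℝ} :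
    t.lift = .func f ↔ t = .func f := by
  cases t <;> simp [lift]

theorem lift_ne_output {n l m : ℕ} (t : GateKind n l m) (i : Fin 1) : t.lift ≠ .output i := by
  cases t <;> simp [lift]

end GateKind

namespace Circuit

variable {A : Set (ℝ → ℝ)} {n l m : ℕ}

theorem kind_outGate (C : Circuit A n l m) (i : Fin m) : C.kind (C.outGate i) = .output i :=
  (C.kind_output _ _).2 rfl

theorem outGate_injective (C : Circuit A n l m) : Function.Injective C.outGate := fun i j h => by
  have := C.kind_outGate i
  rw [h, kind_outGate] at this
  exact (GateKind.output.inj this).symm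

theorem out_le_size (C : Circuit A n l m) : m ≤ C.size := by
  simpa using Fintype.card_le_of_injective _ (C.order.injective.comp C.outGate_injective)

open SelectGate

noncomputable def selectKind (C : Circuit A n l m) : SelectGate C.Gate m → GateKind (n + 1) l 1
  | .old g => (C.kind g).lift
  | .arg => .input 0
  | .node k => .const (-((k : ℝ) + 1))
  | .diff _ => .add
  | .coef j => .const (∏ k ∈ Finset.univ.erase j, ((j : ℝ) - k))⁻¹
  | .term _ => .mul
  | .sum => .add
  | .out => .output 0

-- New edges lead out of former output gates and new gates only, and none leads into an old gate.
-- The gate `sum` is separate from `out` because an output gate must have exactly one predecessor.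
open Classical in
noncomputable def selectPred (C : Circuit A n l m) :
    SelectGate C.Gate m → Finset (SelectGate C.Gate m)
  | .old g => (C.pred g).map oldEmb
  | .arg => ∅
  | .node _ => ∅
  | .diff k => {arg, node k}
  | .coef _ => ∅
  | .term j => insert (old (C.outGate j)) (insert (coef j) ((Finset.univ.erase j).map diffEmb))
  | .sum => Finset.univ.map termEmb
  | .out => {sum}

theorem selectPred_wellFounded (C : Circuit A n l m) :
    WellFounded fun g h => g ∈ C.selectPred h := by
  classical
  have hold : ∀ g, Acc (fun g h => g ∈ C.selectPred h) (old g) := by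
    intro g
    induction g using C.acyclic.induction with
    | _ g ih =>
      refine ⟨_, fun h hh => ?_⟩
      simp only [selectPred, Finset.mem_map] at hh
      obtain ⟨g', hg', rfl⟩ := hh
      exact ih g' hg'
  have harg : Acc (fun g h => g ∈ C.selectPred h) arg := ⟨_, fun h hh => by simp [selectPred] at hh⟩
  have hnode : ∀ k, Acc (fun g h => g ∈ C.selectPred h) (node k) := fun k =>
    ⟨_, fun h hh => by simp [selectPred] at hh⟩
  have hcoef : ∀ k, Acc (fun g h => g ∈ C.selectPred h) (coef k) := fun k =>
    ⟨_, fun h hh => by simp [selectPred] at hh⟩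
  have hdiff : ∀ k, Acc (fun g h => g ∈ C.selectPred h) (diff k) := fun k =>
    ⟨_, fun h hh => by
      simp only [selectPred, Finset.mem_insert, Finset.mem_singleton] at hh
      rcases hh with rfl | rfl
      exacts [harg, hnode k]⟩
  have hterm : ∀ k, Acc (fun g h => g ∈ C.selectPred h) (term k) := fun k =>
    ⟨_, fun h hh => by
      simp only [selectPred, Finset.mem_insert, Finset.mem_map] at hh
      rcases hh with rfl | rfl | ⟨j, -, rfl⟩
      exacts [hold _, hcoef k, hdiff j]⟩
  have hsum : Acc (fun g h => g ∈ C.selectPred h) sum :=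
    ⟨_, fun h hh => by
      simp only [selectPred, Finset.mem_map] at hh
      obtain ⟨j, -, rfl⟩ := hh
      exact hterm j⟩
  refine ⟨fun g => ?_⟩
  cases g with
  | old g => exact hold g
  | arg => exact harg
  | node k => exact hnode k
  | diff k => exact hdiff k
  | coef k => exact hcoef k
  | term k => exact hterm k
  | sum => exact hsum
  | out =>
    refine ⟨_, fun h hh => ?_⟩
    simp only [selectPred, Finset.mem_singleton] at hh
    exact hh ▸ hsum

theorem selectKind_eq_input (C : Circuit A n l m) (g : SelectGate C.Gate m) (i : Fin (n + 1)) :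
    C.selectKind g = .input i ↔
      g = (Fin.cons arg fun i => old (C.inGate i) : Fin (n + 1) → SelectGate C.Gate m) i := by
  cases g with
  | old g =>
    simp only [selectKind, GateKind.lift_eq_input, C.kind_input]
    refine Fin.cases ?_ (fun i => ?_) i <;> simp
  | _ => refine Fin.cases ?_ (fun i => ?_) i <;> simp [selectKind, (Fin.succ_ne_zero _).symm]

theorem old_mem_selectPred_old (C : Circuit A n l m) (g h : C.Gate) :
    old g ∈ C.selectPred (old h) ↔ g ∈ C.pred h := by
  simp [selectPred, oldEmb_apply]

/-- Only former output gates gain successors, and these are not function gates, so the unique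
successor of a function gate remains unique. -/
theorem selectPred_existsUnique (C : Circuit A n l m) (g : SelectGate C.Gate m) (f : ℝ → ℝ)
    (h : C.selectKind g = .func f) : ∃! h, g ∈ C.selectPred h := by
  cases g with
  | old g =>
    have hg : C.kind g = .func f := GateKind.lift_eq_func.1 h
    obtain ⟨h', hh', hu⟩ := C.succ_func _ _ hg
    refine ⟨old h', (C.old_mem_selectPred_old g h').2 hh', fun k hk => ?_⟩
    cases k with
    | old k => exact congrArg old (hu k ((C.old_mem_selectPred_old g k).1 hk))
    | term j =>
      have : g = C.outGate j := by simpa [selectPred, diffEmb_apply] using hk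
      rw [this, kind_outGate] at hg
      cases hg
    | sum => simp [selectPred, termEmb_apply] at hk
    | _ => simp [selectPred] at hk
  | _ => simp [selectKind] at h

/-- The circuit that on input `c, x₁, …, xₙ` interpolates at `c` between the outputs of `C` on
`x₁, …, xₙ`. -/
noncomputable def select (C : Circuit A n l m) : Circuit A (n + 1) l 1 where
  Gate := SelectGate C.Gate m
  size := C.size + (4 * m + 3)
  order := equivSum.trans (((C.order.sumCongr ((finProdFinEquiv.sumCongr (Equiv.refl _)).trans
    finSumFinEquiv))).trans finSumFinEquiv)
  kind := C.selectKind
  pred := C.selectPred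
  acyclic := C.selectPred_wellFounded
  inGate := Fin.cons arg fun i => old (C.inGate i)
  auxGate i := old (C.auxGate i)
  outGate _ := out
  kind_input := C.selectKind_eq_input
  kind_aux g i := by cases g <;> simp [selectKind, GateKind.lift_eq_aux, C.kind_aux]
  kind_output g i := by
    cases g <;> simp [selectKind, GateKind.lift_ne_output, Subsingleton.elim i 0]
  pred_input i := by
    refine Fin.cases ?_ (fun i => ?_) i
    · simp [selectPred]
    · simp [selectPred, C.pred_input]
  pred_aux i := by simp [selectPred, C.pred_aux]
  pred_const g c h := by
    cases g <;> simp [selectKind, GateKind.lift_eq_const] at h <;> simp [selectPred]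
    exact C.pred_const _ _ h
  pred_output i := by simp [selectPred]
  succ_output i h := by cases h <;> simp [selectPred, oldEmb_apply, diffEmb_apply, termEmb_apply]
  func_mem g f h := by
    cases g <;> simp [selectKind, GateKind.lift_eq_func] at h
    exact C.func_mem _ _ h
  pred_func g f h := by
    cases g <;> simp [selectKind, GateKind.lift_eq_func] at h
    simpa [selectPred] using C.pred_func _ _ h
  succ_func := C.selectPred_existsUnique

/-- The values of the gates of the selection circuit. -/
noncomputable def selectValue (C : Circuit A n l m) (c : ℝ) (x : Fin n → ℝ) (a : Fin l → ℝ) :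
    SelectGate C.Gate m → ℝ :=
  C.select.eval (Fin.cons c x) a

/-- This is `eval_eq` with the gates typed as `SelectGate`, so that `selectKind` and `selectPred`
can be unfolded by rewriting. -/
theorem selectValue_eq (C : Circuit A n l m) (c : ℝ) (x : Fin n → ℝ) (a : Fin l → ℝ)
    (g : SelectGate C.Gate m) :
    C.selectValue c x a g =
      match C.selectKind g with
      | .input i => (Fin.cons c x : Fin (n + 1) → ℝ) i
      | .aux i => a i
      | .const c => c
      | .output _ => ∑ h ∈ C.selectPred g, C.selectValue c x a h
      | .add => ∑ h ∈ C.selectPred g, C.selectValue c x a h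
      | .mul => ∏ h ∈ C.selectPred g, C.selectValue c x a h
      | .func f => f (∑ h ∈ C.selectPred g, C.selectValue c x a h) := by
  have h := C.select.eval_eq (Fin.cons c x) a g
  rw [show C.select.kind g = C.selectKind g from rfl] at h
  cases hk : C.selectKind g <;> rw [hk] at h <;> exact h

/-- All predecessors of an old gate are old, so the evaluation inside this part is that of `C`. -/
theorem selectValue_old (C : Circuit A n l m) (c : ℝ) (x : Fin n → ℝ) (a : Fin l → ℝ)
    (g : C.Gate) : C.selectValue c x a (old g) = C.eval x a g := by
  induction g using C.acyclic.induction with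
  | _ g ih =>
    have hs : ∑ h ∈ C.selectPred (old g), C.selectValue c x a h = ∑ h ∈ C.pred g, C.eval x a h := by
      rw [selectPred, Finset.sum_map]
      exact Finset.sum_congr rfl ih
    have hm : ∏ h ∈ C.selectPred (old g), C.selectValue c x a h =
        ∏ h ∈ C.pred g, C.eval x a h := by
      rw [selectPred, Finset.prod_map]
      exact Finset.prod_congr rfl ih
    rw [selectValue_eq, eval_eq, hs, hm, selectKind]
    cases C.kind g <;> rfl

theorem select_outputs (C : Circuit A n l m) (c : ℝ) (x : Fin n → ℝ) (a : Fin l → ℝ) :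
    C.select.outputs (Fin.cons c x) a =
      fun _ => ∑ j, C.outputs x a j * nodeWeight m c j := by
  classical
  funext k
  change C.selectValue c x a out = _
  have hdiff : ∀ k, C.selectValue c x a (diff k) = c + -((k : ℝ) + 1) := fun k => by
    rw [selectValue_eq]
    simp only [selectKind, selectPred]
    rw [Finset.sum_pair (by simp), selectValue_eq, selectValue_eq]
    rfl
  have hterm : ∀ j, C.selectValue c x a (term j) = C.outputs x a j * nodeWeight m c j := fun j => by
    rw [selectValue_eq]
    simp only [selectKind, selectPred]
    rw [Finset.prod_insert (by simp [diffEmb_apply]), Finset.prod_insert (by simp [diffEmb_apply]),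
      Finset.prod_map, selectValue_old, selectValue_eq, nodeWeight]
    simp only [selectKind, outputs]
    congr 2
    exact Finset.prod_congr rfl fun k _ => hdiff k
  rw [selectValue_eq]
  simp only [selectKind, selectPred]
  rw [Finset.sum_singleton, selectValue_eq]
  simp only [selectKind, selectPred]
  rw [Finset.sum_map]
  exact Finset.sum_congr rfl fun j _ => hterm j

theorem Path.le_depth {C : Circuit A n l m} {g h : C.Gate} {k : ℕ} (p : C.Path g h k) :
    k ≤ C.depth :=
  le_csSup C.path_bddAbove ⟨g, h, p⟩

/-- A bound on the lengths of the paths to a gate of the selection circuit. -/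
def selectHeight (d : ℕ) {G : Type} : SelectGate G m → ℕ
  | .old _ => d
  | .arg => 0
  | .node _ => 0
  | .diff _ => 1
  | .coef _ => 0
  | .term _ => d + 2
  | .sum => d + 3
  | .out => d + 4

theorem selectHeight_lt (C : Circuit A n l m) (d : ℕ) {h h' : SelectGate C.Gate m}
    (hh : h ∈ C.selectPred h') :
    (∃ g g', h = old g ∧ h' = old g' ∧ g ∈ C.pred g') ∨ selectHeight d h < selectHeight d h' := by
  cases h' with
  | old g' =>
    simp only [selectPred, Finset.mem_map] at hh
    obtain ⟨g, hg, rfl⟩ := hh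
    exact .inl ⟨g, g', rfl, rfl, hg⟩
  | diff =>
    simp only [selectPred, Finset.mem_insert, Finset.mem_singleton] at hh
    rcases hh with rfl | rfl <;> simp [selectHeight]
  | term =>
    simp only [selectPred, Finset.mem_insert, Finset.mem_map] at hh
    rcases hh with rfl | rfl | ⟨j, -, rfl⟩ <;> simp [selectHeight, diffEmb_apply]
  | sum =>
    simp only [selectPred, Finset.mem_map] at hh
    obtain ⟨j, -, rfl⟩ := hh
    simp [selectHeight, termEmb_apply]
  | out =>
    simp only [selectPred, Finset.mem_singleton] at hh
    simp [selectHeight, hh]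
  | _ => simp [selectPred] at hh

/-- A path stays among the old gates, where the depth of `C` bounds it, until it leaves them for
good; each further edge raises `selectHeight`. The longest path through new gates only, `arg`,
`diff`, `term`, `sum`, `out`, has length `4`, which the bound must cover even if `C` has depth `0`.
-/
theorem select_depth_le (C : Circuit A n l m) : C.select.depth ≤ C.depth + 4 := by
  -- The height alone does not grow along old edges, so the induction also carries a path of the
  -- same length in `C` whenever the endpoint is old.
  have key : ∀ (g h : C.select.Gate) (k : ℕ), C.select.Path g h k →
      k ≤ selectHeight C.depth (h : SelectGate C.Gate m) ∧
        ∀ h' : C.Gate, h = (old h' : SelectGate C.Gate m) → ∃ g', C.Path g' h' k := by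
    intro g h k p
    induction p with
    | nil => exact ⟨Nat.zero_le _, fun h' _ => ⟨h', .nil⟩⟩
    | @snoc h h' k p hp ih =>
      obtain ⟨ih₁, ih₂⟩ := ih
      rcases C.selectHeight_lt C.depth hp with ⟨h₁, h₂, rfl, rfl, hh⟩ | hlt
      · obtain ⟨g₁, hg₁⟩ := ih₂ h₁ rfl
        refine ⟨(hg₁.snoc hh).le_depth, fun h' e => ⟨g₁, ?_⟩⟩
        cases e
        exact hg₁.snoc hh
      · refine ⟨Nat.succ_le_of_lt (ih₁.trans_lt hlt), fun h'' e => ?_⟩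
        subst e
        obtain ⟨h₁, hh, rfl⟩ := Finset.mem_map.1 hp
        obtain ⟨g₁, hg₁⟩ := ih₂ h₁ rfl
        exact ⟨g₁, hg₁.snoc hh⟩
  refine csSup_le' ?_
  rintro k ⟨g, h, p⟩
  refine (key g h k p).1.trans ?_
  cases h <;> simp [selectHeight]

theorem select_size_le (C : Circuit A n l m) : C.select.size ≤ 5 * C.size + 3 := by
  have := C.out_le_size
  change C.size + (4 * m + 3) ≤ _
  omega

/-- A circuit without inputs that outputs `0` and has constant gates with the values `v`. -/
def constants (A : Set (ℝ → ℝ)) {p : ℕ} (v : Fin p → ℝ) : Circuit A 0 0 1 where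
  Gate := Option (Option (Fin p))
  size := p + 1 + 1
  order := ((finSuccEquiv p).symm.optionCongr).trans (finSuccEquiv (p + 1)).symm
  kind
    | none => .output 0
    | some none => .const 0
    | some (some k) => .const (v k)
  pred
    | none => {some none}
    | some _ => ∅
  acyclic := by
    have h : ∀ g, Acc (fun g h : Option (Option (Fin p)) =>
        g ∈ (match h with | none => {some none} | some _ => ∅ :
          Finset (Option (Option (Fin p))))) (some g) :=
      fun g => ⟨_, fun h hh => by simp at hh⟩
    refine ⟨fun g => ?_⟩
    cases g with
    | some g => exact h g
    | none =>
      refine ⟨_, fun g hg => ?_⟩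
      simp only [Finset.mem_singleton] at hg
      exact hg ▸ h none
  inGate := Fin.elim0
  auxGate := Fin.elim0
  outGate _ := none
  kind_input _ i := i.elim0
  kind_aux _ i := i.elim0
  kind_output g i := by
    rcases g with _ | _ | g <;> simp [Subsingleton.elim i 0]
  pred_input i := i.elim0
  pred_aux i := i.elim0
  pred_const g c h := by
    rcases g with _ | g
    · simp at h
    · rfl
  pred_output i := by simp
  succ_output i h := by rcases h with _ | h <;> simp
  func_mem g f h := by rcases g with _ | _ | g <;> simp at h
  pred_func g f h := by rcases g with _ | _ | g <;> simp at h
  succ_func g f h := by rcases g with _ | _ | g <;> simp at h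

theorem constants_eval {p : ℕ} (v : Fin p → ℝ) (x a : Fin 0 → ℝ) (k : Fin p) :
    (constants A v).eval x a (some (some k) : Option (Option (Fin p))) = v k :=
  (constants A v).eval_eq x a (some (some k) : Option (Option (Fin p)))

theorem constants_outputs {p : ℕ} (v : Fin p → ℝ) (x a : Fin 0 → ℝ) :
    (constants A v).outputs x a = fun _ => 0 := by
  funext k
  have h : (constants A v).eval x a (some none : Option (Option (Fin p))) = 0 :=
    (constants A v).eval_eq x a (some none : Option (Option (Fin p)))
  refine ((constants A v).eval_eq x a (none : Option (Option (Fin p)))).trans ?_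
  change ∑ h ∈ ({some none} : Finset (Option (Option (Fin p)))), (constants A v).eval x a h = 0
  exact (Finset.sum_singleton _ _).trans h

end Circuit

/-! ### Recurrent versions of the selection circuit and the constant circuit -/

namespace RecCircuit

variable {A : Set (ℝ → ℝ)} {n l m : ℕ}

/-- The recurrent circuit that interpolates at its first argument between the outputs of `R`. -/
noncomputable def select (R : RecCircuit A n l m) : RecCircuit A (n + 1) l 1 where
  C := R.C.select
  init := R.init
  -- The recurrent edge of the new input is a loop, so the selecting argument survives all
  -- iterations.
  recIn := (Fin.cons .arg fun i => .old (R.recIn i) : Fin (n + 1) → SelectGate R.C.Gate m)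
  recAux i := (.old (R.recAux i) : SelectGate R.C.Gate m)
  recIn_ne i _ := by
    refine Fin.cases ?_ (fun i => ?_) i
    · exact fun h => by cases h
    · exact fun h => by cases h
  recAux_ne _ _ := fun h => by cases h
  p := R.p
  haltGate := R.haltGate.trans SelectGate.oldEmb
  halt := R.halt

/-- The halting gates and the sources of the old recurrent edges are old gates, so both computations
run in parallel and stop in the same iteration; interpolation affects only the final output. -/
theorem Mem.select {R : RecCircuit A n l m} {i : ℕ+} {x : Fin n → ℝ} {a : Fin l → ℝ}
    {o : Fin m → ℝ} (h : R.Mem i x a o) (c : ℝ) :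
    R.select.Mem i (Fin.cons c x) a fun _ => ∑ j, o j * nodeWeight m c j := by
  have hh : ∀ (x : Fin n → ℝ) (a : Fin l → ℝ),
      (fun j => R.select.C.eval (Fin.cons c x) a (R.select.haltGate j)) =
        fun j => R.C.eval x a (R.haltGate j) := fun x a =>
    funext fun j => R.C.selectValue_old c x a _
  induction h with
  | halted i x a h =>
    have := Mem.halted (R := R.select) i (Fin.cons c x) a (by rw [hh]; exact h)
    rwa [show R.select.C.outputs (Fin.cons c x) a = _ from R.C.select_outputs c x a] at this
  | next i x a o h _ ih =>
    refine .next (R := R.select) i (Fin.cons c x) a _ (by rw [hh]; exact h) ?_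
    have h₁ : (fun j => R.select.C.eval (Fin.cons c x) a (R.select.recIn j)) =
        (Fin.cons c fun j => R.C.eval x a (R.recIn j) : Fin (n + 1) → ℝ) := by
      funext j
      refine Fin.cases ?_ (fun j => ?_) j
      · exact R.C.select.eval_eq (Fin.cons c x) a (.arg : SelectGate R.C.Gate m)
      · exact R.C.selectValue_old c x a _
    have h₂ : (fun j => R.select.C.eval (Fin.cons c x) a (R.select.recAux j)) =
        fun j => R.C.eval x a (R.recAux j) := funext fun j => R.C.selectValue_old c x a _
    rw [h₁, h₂]
    exact ih

theorem Mem.exists_halt {R : RecCircuit A n l m} {i : ℕ+} {x : Fin n → ℝ} {a : Fin l → ℝ}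
    {o : Fin m → ℝ} (h : R.Mem i x a o) : ∃ (t : ℕ+) (v : Fin R.p → ℝ), R.halt t v = true := by
  induction h with
  | halted i x a h => exact ⟨i, _, h⟩
  | next _ _ _ _ _ _ ih => exact ih

/-- A recurrent circuit without inputs that outputs `0` and passes the constants `v` to the halting
function. -/
def constants (A : Set (ℝ → ℝ)) {p : ℕ} (halt : ℕ+ → (Fin p → ℝ) → Bool) (v : Fin p → ℝ) :
    RecCircuit A 0 0 1 where
  C := .constants A v
  init := Fin.elim0
  recIn := Fin.elim0
  recAux := Fin.elim0
  recIn_ne i := i.elim0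
  recAux_ne i := i.elim0
  p := p
  haltGate := ⟨fun k => (some (some k) : Option (Option (Fin p))), fun _ _ h =>
    Option.some.inj (Option.some.inj h)⟩
  halt := halt

/-- The halting gates show `v` in every iteration, so the circuit stops in iteration `t` at the
latest, and it outputs `0` whenever it stops. The induction is on the number of iterations left
until `t`. -/
theorem constants_haltsWith {p : ℕ} {halt : ℕ+ → (Fin p → ℝ) → Bool} {v : Fin p → ℝ} {t : ℕ+}
    (h : halt t v = true) (x : Fin 0 → ℝ) : (constants A halt v).HaltsWith x fun _ => 0 := by
  have key : ∀ (k : ℕ) (i : ℕ+) (x a : Fin 0 → ℝ), (i : ℕ) + k = t →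
      (constants A halt v).Mem i x a fun _ => 0 := by
    have hv : ∀ x a : Fin 0 → ℝ, (fun j => (constants A halt v).C.eval x a
        ((constants A halt v).haltGate j)) = v := fun x a =>
      funext fun j => Circuit.constants_eval v x a j
    intro k
    induction k with
    | zero =>
      intro i x a hi
      have hi' : i = t := PNat.eq (by simpa using hi)
      have := Mem.halted (R := constants A halt v) i x a (by rw [hv, hi']; exact h)
      rwa [show (constants A halt v).C.outputs x a = _ from Circuit.constants_outputs v x a] at this
    | succ k ih =>
      intro i x a hi
      cases hh : halt i v with
      | true =>
        have := Mem.halted (R := constants A halt v) i x a (by rw [hv]; exact hh)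
        rwa [show (constants A halt v).C.outputs x a = _ from
          Circuit.constants_outputs v x a] at this
      | false =>
        exact .next (R := constants A halt v) i x a _ (by rw [hv]; exact hh)
          (ih _ _ _ (by rw [PNat.add_coe, PNat.one_coe]; omega))
  refine key ((t : ℕ) - 1) 1 x _ ?_
  have := t.pos
  rw [PNat.one_coe]
  omega

end RecCircuit

/-! ### Bounds -/

/-- The shift replaces `n` by `n + 1` in the bounds, which only enlarges them eventually, and the
additive constant is absorbed because both bounding functions are eventually at least `1`. The
values at `0` play no role. -/
theorem IsFACBound.succ {i : ℕ} {s d s' d' : ℕ → ℕ} (h : IsFACBound i s d) {a b : ℕ}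
    (hs : ∀ n, s' (n + 1) ≤ a * s n + b) (hd : ∀ n, d' (n + 1) ≤ d n + b) :
    IsFACBound i s' d' := by
  obtain ⟨⟨k, hk⟩, hl⟩ := h
  refine ⟨⟨k, ?_⟩, ?_⟩
  · rw [← Filter.map_add_atTop_eq_nat 1, Asymptotics.isBigO_map]
    have h₁ : (fun n => (s n : ℝ)) =O[Filter.atTop] fun n : ℕ => ((n : ℝ) + 1) ^ k :=
      hk.trans (.of_bound' (.of_forall fun n => by
        rw [Real.norm_of_nonneg (by positivity), Real.norm_of_nonneg (by positivity)]
        gcongr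
        linarith))
    have h₂ : (fun _ => (b : ℝ)) =O[Filter.atTop] fun n : ℕ => ((n : ℝ) + 1) ^ k :=
      .of_bound b (.of_forall fun n => by
        rw [Real.norm_of_nonneg (by positivity), Real.norm_of_nonneg (by positivity)]
        exact le_mul_of_one_le_right (by positivity) (one_le_pow₀ (by simp)))
    refine .trans (.of_bound' (.of_forall fun n => ?_))
      (((h₁.const_mul_left (a : ℝ)).add h₂).congr_right fun n => ?_)
    · rw [Function.comp_apply, Real.norm_of_nonneg (by positivity),
        Real.norm_of_nonneg (by positivity)]
      exact_mod_cast hs n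
    · simp
  · rw [← Filter.map_add_atTop_eq_nat 1, Asymptotics.isBigO_map]
    have h₁ : (fun n => (d n : ℝ)) =O[Filter.atTop] fun n : ℕ => Real.log ((n : ℝ) + 1) ^ i := by
      refine hl.trans (.of_bound' ?_)
      filter_upwards [Filter.eventually_ge_atTop 1] with n hn
      have hn' : (1 : ℝ) ≤ n := by exact_mod_cast hn
      have h0 := Real.log_nonneg hn'
      rw [Real.norm_of_nonneg (by positivity), Real.norm_of_nonneg
        (pow_nonneg (Real.log_nonneg (by linarith)) _)]
      gcongr
      linarith
    have h₂ : (fun _ => (b : ℝ)) =O[Filter.atTop] fun n : ℕ => Real.log ((n : ℝ) + 1) ^ i := by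
      refine .of_bound b ?_
      -- From `n = 2` on, `n + 1 ≥ 3 > e`, so the logarithm is at least `1`.
      filter_upwards [Filter.eventually_ge_atTop 2] with n hn
      have hn' : (2 : ℝ) ≤ n := by exact_mod_cast hn
      have h1 : 1 ≤ Real.log ((n : ℝ) + 1) := by
        rw [Real.le_log_iff_exp_le (by linarith)]
        linarith [Real.exp_one_lt_d9]
      rw [Real.norm_of_nonneg (by positivity), Real.norm_of_nonneg (by positivity)]
      exact le_mul_of_one_le_right (by positivity) (one_le_pow₀ h1)
    refine .trans (.of_bound' (.of_forall fun n => ?_)) ((h₁.add h₂).congr_right fun n => ?_)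
    · rw [Function.comp_apply, Real.norm_of_nonneg (by positivity),
        Real.norm_of_nonneg (by positivity)]
      exact_mod_cast hd n
    · simp

/-! ### The layer function -/

/-- The layer function of the network: the first argument selects an output of `f` on the remaining
arguments. -/
noncomputable def selectFun (f : List ℝ → List ℝ) : List ℝ → ℝ
  | [] => 0
  | c :: u => interpolateList c (f u)

/-- The recurrent circuits for `selectFun`. -/
noncomputable def RecCircuitFamily.select {A : Set (ℝ → ℝ)} (R : RecCircuitFamily A)
    (v : Fin (R.circ 0).p → ℝ) : RecCircuitFamily A where
  aux
    | 0 => 0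
    | n + 1 => R.aux n
  out _ := 1
  circ
    -- A layer function is never applied to the empty list, but the family needs a member without
    -- inputs. Its halting function has to come from the given family, hence that of `R.circ 0`,
    -- supplied with values `v` that make it halt.
    | 0 => .constants A (R.circ 0).halt v
    | n + 1 => (R.circ n).select

/-- Selection changes neither the number of halting gates nor the halting function, so the same
family of halting circuits serves. Symmetry of `f` is what makes the layer function independent of
the order of the neighbours. -/
theorem selectFun_mem_tailRecClass {i : ℕ} {B A : Set (ℝ → ℝ)} {R : RecCircuitFamily A}
    {f : List ℝ → List ℝ} (hR : R.IsRecFAC i B) (hf : R.Computes f) (hsym : IsSymmetric f) :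
    selectFun f ∈ tailRecClass i B A := by
  -- The run of the circuit without inputs halts, which yields an iteration number and halting
  -- values accepted by its halting function.
  obtain ⟨o₀, ho₀, -⟩ := hf 0 Fin.elim0
  obtain ⟨t, v, htv⟩ := ho₀.exists_halt
  obtain ⟨hb, H, hH, hH'⟩ := hR
  refine ⟨fun c u w h => by simp only [selectFun, hsym u w h], R.select v,
    ⟨hb.succ (a := 5) (b := 4) (fun n => ?_) fun n => (R.circ n).C.select_depth_le, H, hH, ?_⟩, ?_⟩
  · exact ((R.circ n).C.select_size_le).trans (by omega)
  · rintro (_ | n)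
    exacts [hH' 0, hH' n]
  · rintro (_ | n) x
    · exact ⟨_, RecCircuit.constants_haltsWith htv x, by simp [selectFun, RecCircuitFamily.select]⟩
    · obtain ⟨o, ho, hfo⟩ := hf n (Fin.tail x)
      refine ⟨fun _ => ∑ j, o j * nodeWeight _ (x 0) j, ?_, ?_⟩
      · have := ho.select (x 0)
        rwa [Fin.cons_self_tail] at this
      · have hx : List.ofFn x = x 0 :: List.ofFn (Fin.tail x) := List.ofFn_succ
        simp only [hx, selectFun, hfo, interpolateList_ofFn]
        rfl

/-! ### The network -/

/-- The input nodes are the first `n` vertices, so filtering in vertex order lists them as `x₁, …,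
xₙ`. -/
theorem nbrValues_bipartite {n m : ℕ} (l g : Fin (n + m) → ℝ) (j : Fin m) :
    LabelledGraph.nbrValues ⟨n + m, (bipartite n m).graph, l⟩ g (Fin.natAdd n j) =
      List.ofFn fun i => g (Fin.castAdd m i) := by
  have h : (List.finRange (n + m)).filter (fun w => decide (w.1 < n)) =
      (List.finRange n).map (Fin.castAdd m) := by
    rw [← List.map_id (List.finRange (n + m)), finRange_add_map, List.filter_append,
      List.filter_eq_self.2 (by simp), List.filter_eq_nil_iff.2 (by simp), List.append_nil]
    rfl
  rw [List.ofFn_eq_map, ← Function.comp_def g, ← List.map_map, ← h]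
  unfold LabelledGraph.nbrValues
  refine congrArg (List.map g) (List.filter_congr fun w _ => ?_)
  rw [decide_eq_decide]
  change (n + j.1 < n ∧ n ≤ w.1 ∨ n ≤ n + j.1 ∧ w.1 < n) ↔ _
  omega

/-- The network with a single layer that is given by `F`. -/
def CGNN.single {S : Set (List ℝ → ℝ)} (F : List ℝ → ℝ) (hF : F ∈ S) : CGNN S {id} where
  layer _ := (F, id)
  layer_mem _ := ⟨hF, rfl⟩
  periodic := ⟨1, Nat.one_pos, fun _ => rfl⟩
  halt t _ := decide (t = 1)

theorem CGNN.single_computes {S : Set (List ℝ → ℝ)} {F : List ℝ → ℝ} (hF : F ∈ S)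
    (G : LabelledGraph ℝ) :
    (CGNN.single F hF).Computes G
      ⟨G.card, G.graph, fun v => F (G.label v :: G.nbrValues G.label v)⟩ :=
  ⟨1, by simp [CGNN.HaltsAt, CGNN.single], fun s hs => absurd hs not_lt_one, rfl⟩

end RecGNN

/-! ### The theorem -/

theorem mainTheorem6 (i : ℕ) (A₀ A : Set (ℝ → ℝ))
    (R : RecGNN.RecCircuitFamily (A₀ ∪ A)) (f : List ℝ → List ℝ)
    (hR : R.IsRecFAC i (A₀ ∪ {RecGNN.sign})) (hf : R.Computes f) (hsym : RecGNN.IsSymmetric f) :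
    RecGNN.IsSymbolicLogspaceGraphEncoding
      (RecGNN.bipartiteEncoding :
        RecGNN.Circ (A₀ ∪ {RecGNN.sign}) (A₀ ∪ A) → RecGNN.SymGraph) ∧
    ∃ N : RecGNN.CGNN (RecGNN.tailRecClass i (A₀ ∪ {RecGNN.sign}) (A₀ ∪ A)) {id},
      N.HasFixedLayers 1 ∧
      ∀ (n : ℕ) (x : Fin n → ℝ)
        (H : RecGNN.Circuit (A₀ ∪ {RecGNN.sign}) ((R.circ n).p + 1) 0 1)
        (hH : RecGNN.ComputesHalt H (R.circ n).halt),
        ∃ h : Fin (n + R.out n) → ℝ,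
          N.Computes
            (RecGNN.labelledEncoding RecGNN.bipartiteEncoding
              ⟨n, R.aux n, R.out n, R.circ n, H, hH⟩ x)
            ⟨n + R.out n, (RecGNN.bipartite n (R.out n)).graph, h⟩ ∧
          List.ofFn (fun j : Fin (R.out n) => h (Fin.natAdd n j)) = f (List.ofFn x) := by
  refine ⟨RecGNN.isSymbolicLogspaceGraphEncoding_bipartiteEncoding,
    RecGNN.CGNN.single _ (RecGNN.selectFun_mem_tailRecClass hR hf hsym), fun _ _ => rfl,
    fun n x H hH => ⟨_, RecGNN.CGNN.single_computes _ _, ?_⟩⟩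
  obtain ⟨o, -, ho⟩ := hf n x
  rw [ho]
  congr 1
  funext j
  refine Eq.trans ?_ (RecGNN.interpolateList_node o j)
  set l : Fin (n + R.out n) → ℝ := fun v =>
    RecGNN.Circ.symbolValue ⟨n, R.aux n, R.out n, R.circ n, H, hH⟩ x
      ((RecGNN.bipartite n (R.out n)).label v) with hl
  -- Labels start from `1`, as do the interpolation nodes: output node `j` evaluates the polynomial
  -- at its own node `j + 1`.
  have hout : l (Fin.natAdd n j) = (j : ℝ) + 1 := by
    simp [hl, RecGNN.bipartite, RecGNN.Circ.symbolValue]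
  have hin : (fun k => l (Fin.castAdd _ k)) = x := by
    funext k
    simp [hl, RecGNN.bipartite, RecGNN.Circ.symbolValue]
  change RecGNN.selectFun f (l (Fin.natAdd n j) :: RecGNN.LabelledGraph.nbrValues
    ⟨n + R.out n, (RecGNN.bipartite n (R.out n)).graph, l⟩ l (Fin.natAdd n j)) = _
  rw [RecGNN.nbrValues_bipartite, hin, hout, RecGNN.selectFun, ho]
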